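/- Let $\mathcal X\subset\mathbb R^d$, $\mathcal Z\subset\mathbb R^{d_z}$, $\Phi\subset\mathbb R^{d_\phi}$, $\Theta\subset\mathbb R^{d_\theta}$, let $K,n\ge 1$ be integers, and let $\Delta>0$ be such that $\sup_{x,x'\in\mathcal X}\|x-x'\|<\Delta^{1/2}$ (Euclidean norm). Let $\mathcal D$ be a probability distribution on $\mathcal X$. Let $q(J\mid\mathbf e,\phi,x)$ be the (deterministic or stochastic) encoder posterior, a Markov kernel giving for every codebook $\mathbf e=(e_1,\dots,e_K)\in\mathcal Z^K$, every $\phi\in\Phi$ and $x\in\mathcal X$ a distribution on the latent indices $\{1,\dots,K\}$; let $g_\theta:\mathcal Z\to\mathcal X$, $\theta\in\Theta$, be the decoder (measurable in $(\theta,z)$); and let $q(\mathbf e,\phi,\theta\mid S)$ be a randomized learning algorithm, i.e. a Markov kernel from $\mathcal X^n$ to $\mathcal W=\mathcal Z^K\times\Phi\times\Theta$. For $w=(\mathbf e,\phi,\theta)$ put $l_0(w,x)=\mathbb E_{q(J\mid\mathbf e,\phi,x)}\|x-g_\theta(e_J)\|^2$ and define the generalization error $$\mathrm{gen}(n,\mathcal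 D)=\Big|\mathbb E_{S,X}\,\mathbb E_{q(W\mid S)}\Big[l_0(W,X)-\frac1n\sum_{m=1}^n l_0(W,S_m)\Big]\Big|,$$ where $S=(S_1,\dots,S_n)\sim\mathcal D^{n}$ and $X\sim\mathcal D$ is independent of $(S,W)$. Let $\tilde X=(\tilde X_1,\dots,\tilde X_{2n})\sim\mathcal D^{2n}$ and let $\mathbf T=(T_1,\dots,T_{2n})$ be a uniformly random permutation of $\{1,\dots,2n\}$ independent of $\tilde X$; let $\tilde X_{\mathbf T_0}=(\tilde X_{T_1},\dots,\tilde X_{T_n})$ be the test dataset and $\tilde X_{\mathbf T_1}=(\tilde X_{T_{n+1}},\dots,\tilde X_{T_{2n}})$ the training dataset. For given $\tilde X,\mathbf e,\phi$, let $$\mathbf Q_{\tilde{\mathbf J},\mathbf T}=\prod_{m=1}^n q(\bar J_m\mid\mathbf e,\phi,\tilde X_{T_m})\ \prod_{m=1}^n q(J_m\mid\mathbf e,\phi,\tilde X_{T_{n+m}}),\qquad \mathbf Q_{\tilde{\mathbf J}}=\mathbb E_{\mathbf T}\,\mathbf Q_{\tilde{\mathbf J},\mathbf T},$$ distributions on $\{1,\dots,K\}^{n}\times\{1,\dots,K\}^{n}$,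 where $\mathbb E_{\mathbf T}$ averages over all $(2n)!$ permutations. Then $\mathbb E_{\tilde X,\mathbf T}\,\mathbb E_{q(\mathbf e,\phi\mid\tilde X_{\mathbf T_1})}\mathrm{KL}(\mathbf Q_{\tilde{\mathbf J},\mathbf T}\,\|\,\mathbf Q_{\tilde{\mathbf J}})$ is finite and $$\mathrm{gen}(n,\mathcal D)\le 3\Delta\sqrt{\frac{\mathbb E_{\tilde X,\mathbf T}\,\mathbb E_{q(\mathbf e,\phi\mid\tilde X_{\mathbf T_1})}\mathrm{KL}(\mathbf Q_{\tilde{\mathbf J},\mathbf T}\,\|\,\mathbf Q_{\tilde{\mathbf J}})}{n}}+\frac{\Delta}{\sqrt n}.$$ Here $q(\mathbf e,\phi\mid\cdot)$ is the $(\mathbf e,\phi)$-marginal of the algorithm. -/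

import Mathlib

open MeasureTheory ProbabilityTheory
open scoped ENNReal

noncomputable section

namespace VQVAE

/-- Parameters seen by the encoder side of the model: the codebook `e ∈ 𝒵 ^ K` together with the
encoder parameter `φ ∈ Φ`. -/
abbrev EncParam (K : ℕ) {dz dφ : ℕ} (𝒵 : Set (EuclideanSpace ℝ (Fin dz)))
    (Φ : Set (EuclideanSpace ℝ (Fin dφ))) : Type :=
  (Fin K → 𝒵) × Φ

/-- All parameters `W = (e, φ, θ)` of the model. -/
abbrev Param (K : ℕ) {dz dφ dθ : ℕ} (𝒵 : Set (EuclideanSpace ℝ (Fin dz)))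
    (Φ : Set (EuclideanSpace ℝ (Fin dφ))) (Θ : Set (EuclideanSpace ℝ (Fin dθ))) : Type :=
  EncParam K 𝒵 Φ × Θ

/-- The data space has diameter `sup ‖x - x'‖ < √Δ` with `Δ > 0`
(the extended diameter is used, so boundedness is part of the condition). -/
def DiamLT {d : ℕ} (𝒳 : Set (EuclideanSpace ℝ (Fin d))) (Δ : ℝ) : Prop :=
  0 < Δ ∧ Metric.ediam 𝒳 < ENNReal.ofReal (Real.sqrt Δ)

variable {d dz dφ dθ K n : ℕ}
  {𝒳 : Set (EuclideanSpace ℝ (Fin d))} {𝒵 : Set (EuclideanSpace ℝ (Fin dz))}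
  {Φ : Set (EuclideanSpace ℝ (Fin dφ))} {Θ : Set (EuclideanSpace ℝ (Fin dθ))}

/-- Expected squared reconstruction loss
`l₀(w, x) = 𝔼_{J ∼ q(J | e, φ, x)} ‖x - g_θ(e_J)‖²` for `w = (e, φ, θ)`. -/
def expectedLoss (enc : Kernel (EncParam K 𝒵 Φ × 𝒳) (Fin K)) (g : Θ → 𝒵 → 𝒳)
    (w : Param K 𝒵 Φ Θ) (x : 𝒳) : ℝ :=
  ∫ j, ‖(x : EuclideanSpace ℝ (Fin d)) - (g w.2 (w.1.1 j) : EuclideanSpace ℝ (Fin d))‖ ^ 2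
    ∂(enc (w.1, x))

/-- Generalization error
`|𝔼_{S, X} 𝔼_{W ∼ q(W | S)} [l₀(W, X) - n⁻¹ ∑ₘ l₀(W, Sₘ)]|`, where `S` consists of `n` i.i.d.
samples of `D` and `X ∼ D` is independent of `S` and of `W`. -/
def genError (D : Measure 𝒳) (enc : Kernel (EncParam K 𝒵 Φ × 𝒳) (Fin K)) (g : Θ → 𝒵 → 𝒳)
    (alg : Kernel (Fin n → 𝒳) (Param K 𝒵 Φ Θ)) : ℝ :=
  |∫ s, ∫ x, ∫ w,
      (expectedLoss enc g w x - (1 / (n : ℝ)) * ∑ m : Fin n, expectedLoss enc g w (s m))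
      ∂(alg s) ∂D ∂(Measure.pi fun _ : Fin n => D)|

/-- The test dataset: the first `n` entries of the permuted supersample. -/
def testData (T : Equiv.Perm (Fin (n + n))) (x : Fin (n + n) → 𝒳) : Fin n → 𝒳 :=
  fun m => x (T (Fin.castAdd n m))

/-- The training dataset: the last `n` entries of the permuted supersample. -/
def trainData (T : Equiv.Perm (Fin (n + n))) (x : Fin (n + n) → 𝒳) : Fin n → 𝒳 :=
  fun m => x (T (Fin.natAdd n m))

/-- Joint law `∏ₘ q(Jₘ | e, φ, sₘ)` of the latent indices of a dataset `s`. -/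
def indexLaw (enc : Kernel (EncParam K 𝒵 Φ × 𝒳) (Fin K)) (p : EncParam K 𝒵 Φ)
    (s : Fin n → 𝒳) : Measure (Fin n → Fin K) :=
  Measure.pi fun m => enc (p, s m)

/-- Joint posterior of the latent indices `(J̄, J)` of the test and training data, for a given
supersample `x` and permutation `T`. -/
def jointPosterior (enc : Kernel (EncParam K 𝒵 Φ × 𝒳) (Fin K)) (p : EncParam K 𝒵 Φ)
    (x : Fin (n + n) → 𝒳) (T : Equiv.Perm (Fin (n + n))) :
    Measure ((Fin n → Fin K) × (Fin n → Fin K)) :=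
  (indexLaw enc p (testData T x)).prod (indexLaw enc p (trainData T x))

/-- The permutation symmetric prior: the average of the joint posteriors over all permutations
of the `2n` supersample points. -/
def permPrior (enc : Kernel (EncParam K 𝒵 Φ × 𝒳) (Fin K)) (p : EncParam K 𝒵 Φ)
    (x : Fin (n + n) → 𝒳) : Measure ((Fin n → Fin K) × (Fin n → Fin K)) :=
  ((Nat.factorial (n + n) : ℕ) : ℝ≥0∞)⁻¹ •
    ∑ T : Equiv.Perm (Fin (n + n)), jointPosterior enc p x T

/-- `𝔼_{X̃, T} 𝔼_{(e, φ) ∼ q(e, φ | X̃_{T₁})} KL(Q_{J̃, T} ‖ Q_{J̃})`, with `X̃` consisting of `2n`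
i.i.d. samples of `D`, `T` a uniform permutation independent of `X̃`, and `q(e, φ | ·)` the
`(e, φ)`-marginal of the learning algorithm. -/
def expectedKL (D : Measure 𝒳) (enc : Kernel (EncParam K 𝒵 Φ × 𝒳) (Fin K))
    (alg : Kernel (Fin n → 𝒳) (Param K 𝒵 Φ Θ)) : ℝ≥0∞ :=
  ∫⁻ x, ((Nat.factorial (n + n) : ℕ) : ℝ≥0∞)⁻¹ * ∑ T : Equiv.Perm (Fin (n + n)),
      ∫⁻ p, InformationTheory.klDiv (jointPosterior enc p x T) (permPrior enc p x)
        ∂(alg.fst (trainData T x))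
    ∂(Measure.pi fun _ : Fin (n + n) => D)

end VQVAE

end

/-! Write `a` for the test data, `b` for the training data and `c j = g θ (e j)` for the decoded
centers. For a fixed realisation of `(a, b, W)` only the latent indices are random, so a change of
measure from their product law to its average over permutations costs exactly the divergence in the
theorem. Since `a`, `b`, `c` are frozen at this stage, the dependence of the decoder on the training
data does no harm.

The loss difference is a sum over positions of a score evaluated at the index in that position.
Under the symmetric prior, given the multiset of indices, this is a statistic of a uniform
permutation. Its mean need not vanish: the raw scores of index `j` add up to `-2n⟨ā - b̄, c j⟩`.
Adding `2⟨ā - b̄, c j⟩` at the training positions balances them (`score`). Revealing the positions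
one at a time, test positions first, gives martingale increments of range at most `2Δ`
(`abs_card_mul_score_sub_le`), so Hoeffding's lemma bounds the exponential moment
(`sum_perm_exp_le`). The Gibbs inequality then gives, for every `t > 0`, that the loss difference is
within `entropy / t + t Δ² / n` of `surrogateGap` (`abs_meanLoss_sub_surrogateGap_le`). This bound
is affine in the entropy, so it can be integrated before `t` is optimised, which yields `2Δ√(KL /
n)`.

There remains the expectation of the surrogate. Its correction sits on the training positions only,
so it contains just the mean center `C` selected on the training data, and `C` is independent of
`a`. After centering the data at its mean, only `2 E⟨b̄, C⟩` survives, and this is at most `(V + r)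
/ √n`, where `V` is the variance and `r` bounds `‖C‖²` (`abs_integral_centered_gap_le`). The
bias-variance identity allows `r = Δ - V`, whence `Δ / √n`. -/

namespace VQVAE

/-! ### Exponential moments under uniform permutations -/

/-- Hoeffding's lemma for the uniform distribution on a finite type. -/
lemma sum_exp_le_of_sub_le {ι : Type*} [Fintype ι] [Nonempty ι] (h : ι → ℝ) {C : ℝ}
    (hC : ∀ k k', h k - h k' ≤ C) :
    ∑ k, Real.exp (h k) ≤
      Fintype.card ι * Real.exp ((∑ k, h k) / Fintype.card ι + C ^ 2 / 8) := by
  let _ : MeasurableSpace ι := ⊤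
  have : MeasurableSingletonClass ι := ⟨fun _ => trivial⟩
  obtain ⟨k₀, hk₀⟩ := Finite.exists_min h
  have hC0 : 0 ≤ C := by simpa using hC k₀ k₀
  have hcard : (0 : ℝ) < Fintype.card ι := by exact_mod_cast Fintype.card_pos
  let μ : Measure ι := uniformOn Set.univ
  have : IsProbabilityMeasure μ := isProbabilityMeasure_uniformOn Set.finite_univ Set.univ_nonempty
  have hμ : ∀ k, μ.real {k} = (Fintype.card ι : ℝ)⁻¹ := by
    intro k
    simp [μ, uniformOn_univ, Measure.real]
  have hint : ∀ f : ι → ℝ, ∫ k, f k ∂μ = (∑ k, f k) / Fintype.card ι := by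
    intro f
    rw [integral_fintype Integrable.of_finite, Finset.sum_div]
    refine Finset.sum_congr rfl fun k _ => ?_
    rw [hμ, smul_eq_mul, div_eq_inv_mul]
  have key := (hasSubgaussianMGF_of_mem_Icc (μ := μ) (X := h) (a := h k₀) (b := h k₀ + C)
    (measurable_of_finite h).aemeasurable
    (Filter.Eventually.of_forall fun k => ⟨hk₀ k, by linarith [hC k k₀]⟩)).mgf_le 1
  rw [mgf, hint, hint] at key
  set m := (∑ k, h k) / Fintype.card ι
  have e : (((‖h k₀ + C - h k₀‖₊ / 2) ^ 2 : NNReal) : ℝ) * 1 ^ 2 / 2 = C ^ 2 / 8 := by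
    rw [add_sub_cancel_left]
    push_cast
    rw [Real.norm_eq_abs, div_pow, sq_abs]
    ring
  rw [e, div_le_iff₀ hcard] at key
  calc ∑ k, Real.exp (h k) = Real.exp m * ∑ k, Real.exp (1 * (h k - m)) := by
        rw [Finset.mul_sum]
        refine Finset.sum_congr rfl fun k _ => ?_
        rw [← Real.exp_add]
        ring_nf
    _ ≤ Real.exp m * (Real.exp (C ^ 2 / 8) * Fintype.card ι) := by gcongr
    _ = _ := by rw [Real.exp_add]; ring

/-- Exponential moment bound for the combinatorial statistic `∑ᵢ ψᵢ(y_{σ i})` under a uniformly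
random permutation `σ`, when the entries are revealed one after the other. -/
lemma sum_perm_exp_le {κ : Type*} {C : ℝ} (hC : 0 ≤ C) : ∀ (N : ℕ) (ψ : Fin N → κ → ℝ)
    (_ : ∀ i j j', ((Finset.Ioi i).card : ℝ) * (ψ i j - ψ i j')
      - ∑ l ∈ Finset.Ioi i, (ψ l j - ψ l j') ≤ (Finset.Ioi i).card * C) (y : Fin N → κ),
    ∑ σ : Equiv.Perm (Fin N), Real.exp (∑ i, ψ i (y (σ i))) ≤
      N.factorial * Real.exp ((∑ i, ∑ l, ψ i (y l)) / N + N * (C ^ 2 / 8))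
  | 0, ψ, _, y => by simp
  | M + 1, ψ, hψ, y => by
    set S : ℝ := ∑ i : Fin M, ∑ l, ψ i.succ (y l) with hS
    -- `h k` is the conditional mean of the whole statistic given `σ 0 = k`: the first term plus the
    -- average of the later ones over the entries other than `y k`. For `M = 0` the quotient is `0`,
    -- as it should be.
    let h : Fin (M + 1) → ℝ := fun k =>
      ψ 0 (y k) + (S - ∑ i : Fin M, ψ i.succ (y k)) / M
    have step : ∀ k, ∑ τ : Equiv.Perm (Fin M), Real.exp (∑ i : Fin M,
        ψ i.succ (y (Equiv.swap 0 k (τ i).succ))) ≤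
        M.factorial * Real.exp ((S - ∑ i : Fin M, ψ i.succ (y k)) / M + M * (C ^ 2 / 8)) := by
      intro k
      have := sum_perm_exp_le hC M (fun i => ψ i.succ) (fun i j j' => by
        simpa [← Fin.map_succEmb_Ioi] using hψ i.succ j j')
        (fun l => y (Equiv.swap 0 k l.succ))
      refine this.trans_eq ?_
      congr 3
      congr 1
      rw [hS, ← Finset.sum_sub_distrib]
      refine Finset.sum_congr rfl fun i _ => ?_
      rw [← Equiv.sum_comp (Equiv.swap 0 k) (fun l => ψ i.succ (y l)), Fin.sum_univ_succ]
      simp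
    have hh : ∀ k k', h k - h k' ≤ C := by
      intro k k'
      rcases Nat.eq_zero_or_pos M with rfl | hM
      · rw [Subsingleton.elim (α := Fin 1) k k']; simpa using hC
      · have hM' : (0 : ℝ) < M := by exact_mod_cast hM
        have := hψ 0 (y k) (y k')
        -- Position `0` has `M` successors, so the hypothesis there is `M` times the required bound
        -- on `h k - h k'`.
        rw [Fin.Ioi_zero_eq_map] at this
        simp only [Finset.card_map, Finset.card_univ, Fintype.card_fin, Finset.sum_map,
          Fin.coe_succEmb, Finset.sum_sub_distrib] at this
        refine le_of_mul_le_mul_left ?_ hM'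
        refine le_trans (le_of_eq ?_) this
        simp only [h]
        field_simp
        ring
    have hoeff := sum_exp_le_of_sub_le h hh
    -- Condition on the value of the permutation at `0`; induction handles the rest, and Hoeffding's
    -- lemma the sum over that value.
    rw [← Equiv.sum_comp Equiv.Perm.decomposeFin.symm, Fintype.sum_prod_type]
    simp only [Fin.sum_univ_succ (fun i => ψ i _), Equiv.Perm.decomposeFin_symm_apply_zero,
      Equiv.Perm.decomposeFin_symm_apply_succ, Real.exp_add, ← Finset.mul_sum]
    calc ∑ k, Real.exp (ψ 0 (y k)) * ∑ τ : Equiv.Perm (Fin M), Real.exp (∑ i : Fin M,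
            ψ i.succ (y (Equiv.swap 0 k (τ i).succ)))
        ≤ ∑ k, Real.exp (ψ 0 (y k)) * (M.factorial * Real.exp
            ((S - ∑ i : Fin M, ψ i.succ (y k)) / M + M * (C ^ 2 / 8))) := by
          gcongr with k
          exact step k
      _ = M.factorial * Real.exp (M * (C ^ 2 / 8)) * ∑ k, Real.exp (h k) := by
          rw [Finset.mul_sum]
          refine Finset.sum_congr rfl fun k _ => ?_
          simp only [h, Real.exp_add]
          ring
      _ ≤ M.factorial * Real.exp (M * (C ^ 2 / 8)) * (Fintype.card (Fin (M + 1)) *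
            Real.exp ((∑ k, h k) / Fintype.card (Fin (M + 1)) + C ^ 2 / 8)) := by gcongr
      _ = _ := by
          have hsum : (∑ k, h k) / ((M + 1 : ℕ) : ℝ) =
              (∑ l, ψ 0 (y l) + ∑ i : Fin M, ∑ l, ψ i.succ (y l)) / ((M + 1 : ℕ) : ℝ) := by
            congr 1
            simp only [h, Finset.sum_add_distrib, ← Finset.sum_div, Finset.sum_sub_distrib]
            rw [Finset.sum_comm (f := fun k (i : Fin M) => ψ i.succ (y k)), ← hS]
            rcases Nat.eq_zero_or_pos M with rfl | hM
            · simp [hS]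
            · have hM' : (M : ℝ) ≠ 0 := by positivity
              simp
              field_simp
              ring
          rw [Fintype.card_fin, Fin.sum_univ_succ (fun i => ∑ l, ψ i (y l)), hsum,
            Nat.factorial_succ]
          push_cast
          rw [add_mul (M : ℝ) 1 (C ^ 2 / 8), one_mul]
          simp only [Real.exp_add]
          ring

/-! ### Relative entropy and product masses on finite types -/

/-- Gibbs variational inequality on a finite type. -/
lemma sum_mul_le_relEntropy_add {Ω : Type*} [Fintype Ω] (Q P F : Ω → ℝ) (L : ℝ)
    (hQ : ∀ ω, 0 ≤ Q ω) (hP : ∀ ω, 0 ≤ P ω) (hQ1 : ∑ ω, Q ω = 1)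
    (hac : ∀ ω, P ω = 0 → Q ω = 0)
    (hF : ∑ ω, P ω * Real.exp (F ω) ≤ Real.exp L) :
    ∑ ω, Q ω * F ω ≤ ∑ ω, Q ω * Real.log (Q ω / P ω) + L := by
  have h1 : ∀ ω, Q ω * F ω - Q ω * Real.log (Q ω / P ω) - Q ω * L ≤
      P ω * Real.exp (F ω) * Real.exp (-L) - Q ω := by
    intro ω
    rcases (hQ ω).eq_or_lt with h | h
    · rw [← h]
      have := hP ω
      simp only [zero_mul, sub_zero]
      positivity
    · have hPω : 0 < P ω := (hP ω).lt_of_ne fun h0 => h.ne' (hac ω h0.symm)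
      -- The inequality `log u ≤ u - 1`, used pointwise at `u = (P / Q) exp (F - L)`, avoids
      -- normalising the tilted measure.
      have := Real.log_le_sub_one_of_pos (x := P ω / Q ω * Real.exp (F ω - L)) (by positivity)
      rw [Real.log_mul (by positivity) (by positivity), Real.log_exp, ← inv_div (Q ω) (P ω),
        Real.log_inv] at this
      have h2 := mul_le_mul_of_nonneg_left this h.le
      have e : Q ω * ((Q ω / P ω)⁻¹ * Real.exp (F ω - L) - 1) =
          P ω * Real.exp (F ω) * Real.exp (-L) - Q ω := by
        rw [sub_eq_add_neg (F ω), Real.exp_add]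
        field_simp
      rw [e] at h2
      linarith
  have h2 := Finset.sum_le_sum fun ω (_ : ω ∈ Finset.univ) => h1 ω
  simp only [Finset.sum_sub_distrib, ← Finset.sum_mul, hQ1] at h2
  have h3 : (∑ ω, P ω * Real.exp (F ω)) * Real.exp (-L) ≤ 1 := by
    calc _ ≤ Real.exp L * Real.exp (-L) := by gcongr
      _ = 1 := by rw [← Real.exp_add]; simp
  linarith

/-- The Kullback–Leibler divergence on a finite type as a finite sum. -/
lemma klDiv_eq_ofReal_sum {Ω : Type*} [Fintype Ω] [MeasurableSpace Ω]
    [MeasurableSingletonClass Ω] (Q P : Measure Ω) [IsProbabilityMeasure Q]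
    [IsProbabilityMeasure P] (hac : Q ≪ P) :
    InformationTheory.klDiv Q P =
      ENNReal.ofReal (∑ ω, Q.real {ω} * Real.log (Q.real {ω} / P.real {ω})) := by
  rw [InformationTheory.klDiv_of_ac_of_integrable hac Integrable.of_finite,
    integral_fintype Integrable.of_finite]
  simp only [probReal_univ, add_sub_cancel_right, smul_eq_mul]
  congr 1
  refine Finset.sum_congr rfl fun ω _ => ?_
  by_cases h0 : Q.real {ω} = 0
  · simp [h0]
  have hP0 : P.real {ω} ≠ 0 := by
    intro h
    apply h0
    rw [measureReal_eq_zero_iff] at h ⊢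
    exact hac h
  congr 2
  have := congrArg (fun ν : Measure Ω => ν {ω}) (Measure.withDensity_rnDeriv_eq Q P hac)
  simp only [withDensity_apply _ (measurableSet_singleton ω), Measure.restrict_singleton,
    lintegral_smul_measure, lintegral_dirac, smul_eq_mul] at this
  rw [measureReal_def, ← this, ENNReal.toReal_mul, mul_comm, ← measureReal_def,
    mul_div_assoc, div_self hP0, mul_one, llr]

/-- Marginalisation of a product mass function. -/
lemma sum_prod_mul_eval {ι κ : Type*} [Fintype ι] [DecidableEq ι] [Fintype κ] (q : ι → κ → ℝ)
    (hq : ∀ i, ∑ j, q i j = 1) (k : ι) (f : κ → ℝ) :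
    ∑ ω : ι → κ, (∏ i, q i (ω i)) * f (ω k) = ∑ j, q k j * f j := by
  classical
  have h := Fintype.piFinset_univ (α := ι) (β := fun _ => κ)
  have := Finset.prod_univ_sum (fun _ : ι => (Finset.univ : Finset κ))
    (fun i j => q i j * if i = k then f j else 1)
  rw [h] at this
  rw [← Finset.mul_prod_erase _ _ (Finset.mem_univ k)] at this
  rw [Finset.prod_eq_one (s := Finset.univ.erase k)] at this
  · simp only [if_true, mul_one] at this
    rw [this]
    refine Finset.sum_congr rfl fun ω _ => ?_
    rw [Finset.prod_mul_distrib]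
    simp
  · intro i hi
    simp [Finset.ne_of_mem_erase hi, hq]

lemma sum_prod_eq_one {ι κ : Type*} [Fintype ι] [DecidableEq ι] [Fintype κ] (q : ι → κ → ℝ)
    (hq : ∀ i, ∑ j, q i j = 1) : ∑ ω : ι → κ, ∏ i, q i (ω i) = 1 := by
  have := Finset.prod_univ_sum (fun _ : ι => (Finset.univ : Finset κ)) q
  rw [Fintype.piFinset_univ] at this
  rw [← this]
  simp [hq]

section

/-! ### Balanced scores and their increments -/

section Score

variable {E κ : Type*} [NormedAddCommGroup E] [InnerProductSpace ℝ E] {n : ℕ}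

/-- Arithmetic mean of finitely many vectors. -/
noncomputable def average (a : Fin n → E) : E := (n : ℝ)⁻¹ • ∑ m, a m

/-- Balanced per-position scores: the loss difference between test points `a` and training points
`b` under centers `c`, corrected so that the scores of a fixed index sum to zero over positions. -/
noncomputable def score (a b : Fin n → E) (c : κ → E) : Fin (n + n) → κ → ℝ :=
  Fin.addCases (fun m j => ‖c j‖ ^ 2 - 2 * inner ℝ (a m) (c j))
    (fun m j => -‖c j‖ ^ 2 + 2 * inner ℝ (b m + (average a - average b)) (c j))

lemma score_castAdd (a b : Fin n → E) (c : κ → E) (m : Fin n) (j : κ) :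
    score a b c (Fin.castAdd n m) j = ‖c j‖ ^ 2 - 2 * inner ℝ (a m) (c j) := by
  simp [score]

lemma score_natAdd (a b : Fin n → E) (c : κ → E) (m : Fin n) (j : κ) :
    score a b c (Fin.natAdd n m) j =
      -‖c j‖ ^ 2 + 2 * inner ℝ (b m + (average a - average b)) (c j) := by
  rw [score, Fin.addCases_right]

/-- This balance is the purpose of the correction `average a - average b`: the squared norms cancel,
and the correction, repeated `n` times, makes up for the difference of the two sums of inner
products. -/
lemma sum_score_natAdd (hn : 1 ≤ n) (a b : Fin n → E) (c : κ → E) (j : κ) :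
    ∑ m, score a b c (Fin.natAdd n m) j = -∑ m, score a b c (Fin.castAdd n m) j := by
  have hn' : (n : ℝ) ≠ 0 := by positivity
  have : ∀ v : Fin n → E, (n : ℝ) * inner ℝ (average v) (c j) = ∑ m, inner ℝ (v m) (c j) := by
    intro v
    rw [average, real_inner_smul_left, sum_inner, mul_inv_cancel_left₀ hn']
  simp only [score_natAdd, score_castAdd, Finset.sum_add_distrib, Finset.sum_sub_distrib,
    inner_add_left, inner_sub_left, mul_add, mul_sub, ← Finset.mul_sum, Finset.sum_const,
    Finset.card_univ, Fintype.card_fin, nsmul_eq_mul]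
  linear_combination 2 * this a - 2 * this b

lemma sum_score (hn : 1 ≤ n) (a b : Fin n → E) (c : κ → E) (j : κ) :
    ∑ i, score a b c i j = 0 := by
  rw [Fin.sum_univ_add, sum_score_natAdd hn, add_neg_cancel]

lemma abs_score_castAdd_sub_le (a b : Fin n → E) (c : κ → E) {Δ : ℝ}
    (hac : ∀ m j, ‖a m - c j‖ ^ 2 ≤ Δ) (m : Fin n) (j j' : κ) :
    |score a b c (Fin.castAdd n m) j - score a b c (Fin.castAdd n m) j'| ≤ Δ := by
  have h1 := hac m j
  have h2 := hac m j'
  have h3 := sq_nonneg ‖a m - c j‖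
  have h4 := sq_nonneg ‖a m - c j'‖
  rw [norm_sub_sq_real] at h1 h2 h3 h4
  rw [score_castAdd, score_castAdd, abs_le]
  constructor <;> linarith

lemma abs_inner_sub_sub_le {Δ : ℝ} {u v w z : E} (h1 : ‖u - v‖ ^ 2 ≤ Δ) (h2 : ‖w - z‖ ^ 2 ≤ Δ) :
    |inner ℝ (u - v) (w - z)| ≤ Δ := by
  have := abs_real_inner_le_norm (u - v) (w - z)
  nlinarith [sq_nonneg (‖u - v‖ - ‖w - z‖)]

/-- This is the increment condition of `sum_perm_exp_le` with `C = 2 * Δ`. Between two positions of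
the same kind, everything but a product of two data differences cancels. Test and training positions
are not compared termwise, because the correction would enlarge the constant. -/
lemma abs_card_mul_score_sub_le (hn : 1 ≤ n) (a b : Fin n → E) (c : κ → E) {Δ : ℝ}
    (hac : ∀ m j, ‖a m - c j‖ ^ 2 ≤ Δ) (haa : ∀ m m', ‖a m - a m'‖ ^ 2 ≤ Δ)
    (hbb : ∀ m m', ‖b m - b m'‖ ^ 2 ≤ Δ) (hcc : ∀ j j', ‖c j - c j'‖ ^ 2 ≤ Δ)
    (i : Fin (n + n)) (j j' : κ) :
    |((Finset.Ioi i).card : ℝ) * (score a b c i j - score a b c i j')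
      - ∑ l ∈ Finset.Ioi i, (score a b c l j - score a b c l j')| ≤
      (Finset.Ioi i).card * (2 * Δ) := by
  set D : Fin (n + n) → ℝ := fun l => score a b c l j - score a b c l j' with hD
  have hΔ : 0 ≤ Δ := (sq_nonneg _).trans (hcc j j')
  have hcast : ∀ m m', |D (Fin.castAdd n m) - D (Fin.castAdd n m')| ≤ 2 * Δ := by
    intro m m'
    have := abs_inner_sub_sub_le (haa m m') (hcc j j')
    have e : D (Fin.castAdd n m) - D (Fin.castAdd n m') =
        -2 * inner ℝ (a m - a m') (c j - c j') := by
      simp only [hD, score_castAdd, inner_sub_left, inner_sub_right]; ring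
    rw [e, abs_mul]
    norm_num
    exact this
  have hnat : ∀ m m', |D (Fin.natAdd n m) - D (Fin.natAdd n m')| ≤ 2 * Δ := by
    intro m m'
    have := abs_inner_sub_sub_le (hbb m m') (hcc j j')
    have e : D (Fin.natAdd n m) - D (Fin.natAdd n m') =
        2 * inner ℝ (b m - b m') (c j - c j') := by
      simp only [hD, score_natAdd, inner_sub_left, inner_sub_right, inner_add_left]; ring
    rw [e, abs_mul]
    norm_num
    exact this
  have h1 : ∀ D : Fin (n + n) → ℝ, ((Finset.Ioi i).card : ℝ) * D i - ∑ l ∈ Finset.Ioi i, D l =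
      ∑ l, if i < l then D i - D l else 0 := by
    intro D
    rw [← Finset.sum_filter, Finset.filter_lt_eq_Ioi, Finset.sum_sub_distrib, Finset.sum_const,
      nsmul_eq_mul]
  have h2 : ((Finset.Ioi i).card : ℝ) * (2 * Δ) = ∑ l, if i < l then 2 * Δ else 0 := by
    rw [← Finset.sum_filter, Finset.filter_lt_eq_Ioi, Finset.sum_const, nsmul_eq_mul]
  change |((Finset.Ioi i).card : ℝ) * D i - ∑ l ∈ Finset.Ioi i, D l| ≤ _
  rw [h1, h2, Fin.sum_univ_add, Fin.sum_univ_add]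
  refine (abs_add_le _ _).trans (add_le_add ?_ ?_)
  · refine (Finset.abs_sum_le_sum_abs _ _).trans (Finset.sum_le_sum fun l _ => ?_)
    split_ifs with hl
    · induction i using Fin.addCases with
      | left m => exact hcast m l
      | right m => exact absurd hl (by simp [Fin.lt_def]; omega)
    · simp
  · induction i using Fin.addCases with
    | left m =>
      have hlt : ∀ l : Fin n, Fin.castAdd n m < Fin.natAdd n l := fun l => by
        simp [Fin.lt_def]; omega
      -- Every training position comes after a test position, so their whole block is present and by
      -- balance equals minus the test block. Each `D i - D l` becomes a sum of two test
      -- differences, each at most `Δ`.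
      simp only [hlt, if_true]
      have hs : ∑ l : Fin n, D (Fin.natAdd n l) = -∑ l : Fin n, D (Fin.castAdd n l) := by
        simp only [hD, Finset.sum_sub_distrib, sum_score_natAdd hn]; ring
      rw [Finset.sum_sub_distrib, hs, sub_neg_eq_add, ← Finset.sum_add_distrib]
      refine (Finset.abs_sum_le_sum_abs _ _).trans (Finset.sum_le_sum fun l _ => ?_)
      have h3 := abs_score_castAdd_sub_le a b c hac m j j'
      have h4 := abs_score_castAdd_sub_le a b c hac l j j'
      refine (abs_add_le _ _).trans ?_
      linarith
    | right m =>
      refine (Finset.abs_sum_le_sum_abs _ _).trans (Finset.sum_le_sum fun l _ => ?_)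
      split_ifs with hl
      · exact hnat m l
      · simp

end Score

/-! ### Change of measure to the permutation average -/

section Mass

variable {κ : Type*} {N : ℕ}

/-- Mass function of independent indices `ω i` with mass functions `q i`. -/
def prodMass (q : Fin N → κ → ℝ) (ω : Fin N → κ) : ℝ := ∏ i, q i (ω i)

/-- Average of the product mass functions over all orderings of the factors. -/
noncomputable def permMass (q : Fin N → κ → ℝ) (ω : Fin N → κ) : ℝ :=
  (N.factorial : ℝ)⁻¹ * ∑ T : Equiv.Perm (Fin N), prodMass (fun i => q (T i)) ω

/-- Relative entropy of the product mass function with respect to its permutation average. -/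
noncomputable def permEntropy [Fintype κ] (q : Fin N → κ → ℝ) : ℝ :=
  ∑ ω, prodMass q ω * Real.log (prodMass q ω / permMass q ω)

lemma prodMass_nonneg {q : Fin N → κ → ℝ} (hq : ∀ i j, 0 ≤ q i j) (ω : Fin N → κ) :
    0 ≤ prodMass q ω := Finset.prod_nonneg fun i _ => hq i _

lemma permMass_nonneg {q : Fin N → κ → ℝ} (hq : ∀ i j, 0 ≤ q i j) (ω : Fin N → κ) :
    0 ≤ permMass q ω :=
  mul_nonneg (by positivity) (Finset.sum_nonneg fun T _ => prodMass_nonneg (fun i => hq (T i)) ω)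

lemma prodMass_le {q : Fin N → κ → ℝ} (hq : ∀ i j, 0 ≤ q i j) (ω : Fin N → κ) :
    prodMass q ω ≤ N.factorial * permMass q ω := by
  have : (N.factorial : ℝ) ≠ 0 := by positivity
  rw [permMass, mul_inv_cancel_left₀ this]
  exact Finset.single_le_sum (f := fun T : Equiv.Perm (Fin N) => prodMass (fun i => q (T i)) ω)
    (fun T _ => prodMass_nonneg (fun i => hq (T i)) ω) (Finset.mem_univ 1)

/-- A sample of the averaged law is a product sample `y` composed with a uniform permutation. For
each fixed `y` the permutation bound applies, and its mean term vanishes because the scores are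
balanced. -/
lemma sum_permMass_mul_exp_le [Fintype κ] {C : ℝ} (hC : 0 ≤ C) {q : Fin N → κ → ℝ}
    (hq : ∀ i j, 0 ≤ q i j) (hq1 : ∀ i, ∑ j, q i j = 1) (ψ : Fin N → κ → ℝ)
    (hψ : ∀ i j j', ((Finset.Ioi i).card : ℝ) * (ψ i j - ψ i j')
      - ∑ l ∈ Finset.Ioi i, (ψ l j - ψ l j') ≤ (Finset.Ioi i).card * C)
    (hψ0 : ∀ j, ∑ i, ψ i j = 0) :
    ∑ ω, permMass q ω * Real.exp (∑ i, ψ i (ω i)) ≤ Real.exp (N * (C ^ 2 / 8)) := by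
  have hN : (0 : ℝ) < N.factorial := by positivity
  have e : ∑ ω, permMass q ω * Real.exp (∑ i, ψ i (ω i)) = (N.factorial : ℝ)⁻¹ *
      ∑ y, prodMass q y * ∑ T : Equiv.Perm (Fin N), Real.exp (∑ i, ψ i (y (T i))) := by
    simp only [permMass, mul_assoc, Finset.sum_mul, ← Finset.mul_sum]
    rw [Finset.sum_comm]
    simp only [Finset.mul_sum]
    conv_rhs => rw [Finset.sum_comm]
    refine Finset.sum_congr rfl fun T _ => ?_
    -- Substituting `ω = y ∘ T` moves the permutation from the mass functions to the arguments of
    -- `ψ`.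
    rw [← Equiv.sum_comp (Equiv.arrowCongr T.symm (Equiv.refl κ))]
    refine Finset.sum_congr rfl fun y _ => ?_
    have : prodMass (fun i => q (T i)) (Equiv.arrowCongr T.symm (Equiv.refl κ) y) =
        prodMass q y := by
      rw [prodMass, prodMass, ← Equiv.prod_comp T (fun i => q i (y i))]
      rfl
    rw [this]
    rfl
  rw [e]
  have h := fun y => sum_perm_exp_le hC N ψ hψ y
  have h0 : ∀ y : Fin N → κ, ∑ i, ∑ l, ψ i (y l) = 0 := fun y => by
    rw [Finset.sum_comm]; simp [hψ0]
  calc _ ≤ (N.factorial : ℝ)⁻¹ * ∑ y, prodMass q y *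
        (N.factorial * Real.exp (N * (C ^ 2 / 8))) := by
        gcongr with y
        · exact prodMass_nonneg hq y
        · simpa [h0] using h y
    _ = _ := by
        rw [← Finset.sum_mul]
        have : ∑ y, prodMass q y = 1 := sum_prod_eq_one q hq1
        rw [this]
        field_simp

lemma sum_prodMass_mul_sum [Fintype κ] {q : Fin N → κ → ℝ} (hq1 : ∀ i, ∑ j, q i j = 1)
    (ψ : Fin N → κ → ℝ) :
    ∑ ω, prodMass q ω * ∑ i, ψ i (ω i) = ∑ i, ∑ j, q i j * ψ i j := by
  simp only [Finset.mul_sum]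
  rw [Finset.sum_comm]
  exact Finset.sum_congr rfl fun i _ => sum_prod_mul_eval q hq1 i (ψ i)

lemma sum_mul_le_permEntropy_add [Fintype κ] {C : ℝ} (hC : 0 ≤ C) {q : Fin N → κ → ℝ}
    (hq : ∀ i j, 0 ≤ q i j) (hq1 : ∀ i, ∑ j, q i j = 1) (ψ : Fin N → κ → ℝ)
    (hψ : ∀ i j j', ((Finset.Ioi i).card : ℝ) * (ψ i j - ψ i j')
      - ∑ l ∈ Finset.Ioi i, (ψ l j - ψ l j') ≤ (Finset.Ioi i).card * C)
    (hψ0 : ∀ j, ∑ i, ψ i j = 0) :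
    ∑ i, ∑ j, q i j * ψ i j ≤ permEntropy q + N * (C ^ 2 / 8) := by
  rw [← sum_prodMass_mul_sum hq1]
  refine sum_mul_le_relEntropy_add _ _ _ _ (prodMass_nonneg hq) (permMass_nonneg hq)
    (sum_prod_eq_one q hq1) (fun ω h => ?_) (sum_permMass_mul_exp_le hC hq hq1 ψ hψ hψ0)
  have := prodMass_le hq ω
  rw [h, mul_zero] at this
  exact le_antisymm this (prodMass_nonneg hq ω)

/-- The Gibbs bound for the zero statistic. -/
lemma permEntropy_nonneg [Fintype κ] {q : Fin N → κ → ℝ}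
    (hq : ∀ i j, 0 ≤ q i j) (hq1 : ∀ i, ∑ j, q i j = 1) : 0 ≤ permEntropy q := by
  simpa using sum_mul_le_permEntropy_add le_rfl hq hq1 (fun _ _ => 0) (by simp) (by simp)

/-- The identity is one of the `N!` permutations averaged, so the density ratio never exceeds `N!`.
Finiteness of the expected divergence and all integrability of the entropy rest on this. -/
lemma permEntropy_le [Fintype κ] {q : Fin N → κ → ℝ}
    (hq : ∀ i j, 0 ≤ q i j) (hq1 : ∀ i, ∑ j, q i j = 1) :
    permEntropy q ≤ Real.log N.factorial := by
  calc permEntropy q ≤ ∑ ω, prodMass q ω * Real.log N.factorial := by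
        refine Finset.sum_le_sum fun ω _ => ?_
        have h0 := prodMass_nonneg hq ω
        rcases h0.eq_or_lt with h | h
        · rw [← h]; simp
        have h1 := prodMass_le hq ω
        have hP : 0 < permMass q ω := by
          rcases (permMass_nonneg hq ω).eq_or_lt with h' | h'
          · rw [← h'] at h1; linarith
          · exact h'
        gcongr
        rwa [div_le_iff₀ hP]
    _ = _ := by
        rw [← Finset.sum_mul]
        have : ∑ y, prodMass q y = 1 := sum_prod_eq_one q hq1
        rw [this, one_mul]

end Mass

/-! ### Pointwise comparison of the loss gap with its surrogate -/

variable {E κ : Type*} [NormedAddCommGroup E] [InnerProductSpace ℝ E] [Fintype κ] {n : ℕ}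

/-- Mean squared distance of data `s` to centers `c` under index probabilities `q`. -/
noncomputable def meanLoss (q : Fin n → κ → ℝ) (s : Fin n → E) (c : κ → E) : ℝ :=
  (n : ℝ)⁻¹ * ∑ m, ∑ j, q m j * ‖s m - c j‖ ^ 2

/-- Mean selected center under index probabilities `q`. -/
noncomputable def meanCenter (q : Fin n → κ → ℝ) (c : κ → E) : E :=
  average fun m => ∑ j, q m j • c j

/-- Index-independent surrogate of the loss difference between test and training data. -/
noncomputable def surrogateGap (q : Fin n → κ → ℝ) (a b : Fin n → E) (c : κ → E) : ℝ :=
  (n : ℝ)⁻¹ * (∑ m, ‖a m‖ ^ 2 - ∑ m, ‖b m‖ ^ 2)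
    - 2 * inner ℝ (average a - average b) (meanCenter q c)

/-- Expanding the squares, `‖a m‖²` and `‖b m‖²` do not involve the index and go to the surrogate,
as does the correction, averaged over the training indices. -/
lemma sum_mul_score_eq (hn : 1 ≤ n) {q : Fin (n + n) → κ → ℝ} (hq1 : ∀ i, ∑ j, q i j = 1)
    (a b : Fin n → E) (c : κ → E) :
    ∑ i, ∑ j, q i j * score a b c i j =
      n * (meanLoss (fun m => q (Fin.castAdd n m)) a c
        - meanLoss (fun m => q (Fin.natAdd n m)) b c
        - surrogateGap (fun m => q (Fin.natAdd n m)) a b c) := by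
  have hn' : (n : ℝ) ≠ 0 := by positivity
  have hd : ∀ (i : Fin (n + n)) (v : E), ∑ j, q i j * ‖v - c j‖ ^ 2 =
      ‖v‖ ^ 2 - 2 * ∑ j, q i j * inner ℝ v (c j) + ∑ j, q i j * ‖c j‖ ^ 2 := by
    intro i v
    simp only [norm_sub_sq_real, mul_add, mul_sub, Finset.sum_add_distrib,
      Finset.sum_sub_distrib, ← Finset.sum_mul, hq1, one_mul, Finset.mul_sum]
    congr 3
    ext j
    ring
  have hm : (n : ℝ) * inner ℝ (average a - average b) (meanCenter (fun m => q (Fin.natAdd n m)) c)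
      = ∑ m, ∑ j, q (Fin.natAdd n m) j * inner ℝ (average a - average b) (c j) := by
    rw [meanCenter, average, average, average, real_inner_smul_right, mul_inv_cancel_left₀ hn',
      inner_sum]
    simp only [inner_sum, real_inner_smul_right]
  have h2 : (n : ℝ) * surrogateGap (fun m => q (Fin.natAdd n m)) a b c =
      (∑ m, ‖a m‖ ^ 2 - ∑ m, ‖b m‖ ^ 2)
      - 2 * ∑ m, ∑ j, q (Fin.natAdd n m) j * inner ℝ (average a - average b) (c j) := by
    rw [surrogateGap, mul_sub, mul_inv_cancel_left₀ hn', ← hm]; ring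
  rw [mul_sub, mul_sub, h2, meanLoss, meanLoss, mul_inv_cancel_left₀ hn',
    mul_inv_cancel_left₀ hn', Fin.sum_univ_add]
  simp only [hd, score_castAdd, score_natAdd, mul_sub, mul_add, mul_neg, inner_add_left,
    Finset.sum_add_distrib, Finset.sum_sub_distrib, Finset.sum_neg_distrib, Finset.mul_sum]
  simp only [mul_left_comm (2 : ℝ)]
  ring

lemma abs_meanLoss_sub_surrogateGap_le (hn : 1 ≤ n) {q : Fin (n + n) → κ → ℝ}
    (hq : ∀ i j, 0 ≤ q i j) (hq1 : ∀ i, ∑ j, q i j = 1)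
    (a b : Fin n → E) (c : κ → E) {Δ : ℝ} (hΔ : 0 ≤ Δ)
    (hac : ∀ m j, ‖a m - c j‖ ^ 2 ≤ Δ) (haa : ∀ m m', ‖a m - a m'‖ ^ 2 ≤ Δ)
    (hbb : ∀ m m', ‖b m - b m'‖ ^ 2 ≤ Δ) (hcc : ∀ j j', ‖c j - c j'‖ ^ 2 ≤ Δ)
    {t : ℝ} (ht : 0 < t) :
    |meanLoss (fun m => q (Fin.castAdd n m)) a c - meanLoss (fun m => q (Fin.natAdd n m)) b c
        - surrogateGap (fun m => q (Fin.natAdd n m)) a b c| ≤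
      permEntropy q / t + t * Δ ^ 2 / n := by
  have hn' : (0 : ℝ) < n := by positivity
  have main : ∀ s : ℝ, s * (∑ i, ∑ j, q i j * score a b c i j) ≤
      permEntropy q + n * (s ^ 2 * Δ ^ 2) := by
    intro s
    -- With `2n` positions and range `2|s|Δ`, the exponent `N C² / 8` is `n s² Δ²`. Both signs of
    -- `s` are needed for the absolute value.
    have := sum_mul_le_permEntropy_add (C := |s| * (2 * Δ)) (by positivity) hq hq1
      (fun i j => s * score a b c i j) (fun i j j' => by
        have h := abs_card_mul_score_sub_le hn a b c hac haa hbb hcc i j j'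
        simp only [← mul_sub, ← Finset.mul_sum]
        rw [mul_left_comm, ← mul_sub, mul_left_comm]
        refine (le_abs_self _).trans ?_
        rw [abs_mul]
        gcongr) (fun j => by rw [← Finset.mul_sum, sum_score hn, mul_zero])
    rw [mul_pow, sq_abs] at this
    push_cast at this
    simp only [mul_left_comm _ s, ← Finset.mul_sum] at this
    linarith
  set A := meanLoss (fun m => q (Fin.castAdd n m)) a c - meanLoss (fun m => q (Fin.natAdd n m)) b c
        - surrogateGap (fun m => q (Fin.natAdd n m)) a b c
  rw [sum_mul_score_eq hn hq1] at main
  have h1 := main (t / n)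
  have h2 := main (-(t / n))
  have e1 : t / n * (n * A) = t * A := by field_simp
  have e2 : n * ((t / n) ^ 2 * Δ ^ 2) = t * (t * Δ ^ 2 / n) := by field_simp
  have e3 : permEntropy q = t * (permEntropy q / t) := by field_simp
  rw [neg_sq, neg_mul, e1, e2, e3] at h2
  rw [e1, e2, e3] at h1
  rw [abs_le]
  constructor
  · refine le_of_mul_le_mul_left ?_ ht
    linarith
  · refine le_of_mul_le_mul_left ?_ ht
    linarith

end

/-! ### Expectation of the surrogate gap -/

section

variable {E : Type*} [NormedAddCommGroup E] [InnerProductSpace ℝ E]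

lemma norm_average_le {n : ℕ} {v : Fin n → E} {B : ℝ} (hB : 0 ≤ B) (hv : ∀ m, ‖v m‖ ≤ B) :
    ‖average v‖ ≤ B := by
  rcases Nat.eq_zero_or_pos n with rfl | hn
  · simpa [average] using hB
  have hn' : (0 : ℝ) < n := by exact_mod_cast hn
  rw [average, norm_smul, norm_inv, Real.norm_natCast, inv_mul_le_iff₀ hn']
  refine (norm_sum_le _ _).trans ?_
  simpa using Finset.sum_le_sum fun m (_ : m ∈ Finset.univ) => hv m

lemma norm_meanCenter_le {κ : Type*} [Fintype κ] {n : ℕ} {q : Fin n → κ → ℝ}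
    (hq : ∀ i j, 0 ≤ q i j) (hq1 : ∀ i, ∑ j, q i j = 1) {c : κ → E} {B : ℝ} (hB : 0 ≤ B)
    (hc : ∀ j, ‖c j‖ ≤ B) : ‖meanCenter q c‖ ≤ B := by
  refine norm_average_le hB fun m => ?_
  calc ‖∑ j, q m j • c j‖ ≤ ∑ j, q m j * B := by
        refine (norm_sum_le _ _).trans (Finset.sum_le_sum fun j _ => ?_)
        rw [norm_smul, Real.norm_of_nonneg (hq m j)]
        exact mul_le_mul_of_nonneg_left (hc j) (hq m j)
    _ = B := by rw [← Finset.sum_mul, hq1, one_mul]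

variable [MeasurableSpace E] [BorelSpace E] [SecondCountableTopology E]
  {α W : Type*} [MeasurableSpace α] [MeasurableSpace W] {n : ℕ}

lemma measurable_average {Y : α → E} (hY : Measurable Y) :
    Measurable fun s : Fin n → α => average fun m => Y (s m) := by
  unfold average
  fun_prop

lemma integral_inner_eval_eval [CompleteSpace E] (D : Measure α) [IsProbabilityMeasure D] {Y : α → E}
    (hY : Measurable Y) {B : ℝ} (hB : ∀ x, ‖Y x‖ ≤ B) (h0 : ∫ x, Y x ∂D = 0) {m l : Fin n}
    (hml : m ≠ l) :
    ∫ s, inner ℝ (Y (s m)) (Y (s l)) ∂(Measure.pi fun _ : Fin n => D) = 0 := by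
  have hind : IndepFun (fun s : Fin n → α => s m) (fun s => s l)
      (Measure.pi fun _ : Fin n => D) :=
    (iIndepFun_pi (μ := fun _ : Fin n => D) (X := fun _ x => x)
      fun _ => aemeasurable_id).indepFun hml
  have hmap := (indepFun_iff_map_prod_eq_prod_map_map (measurable_pi_apply m).aemeasurable
    (measurable_pi_apply l).aemeasurable).1 hind
  have e : ∀ i : Fin n, (Measure.pi fun _ : Fin n => D).map (fun s => s i) = D := fun i =>
    (measurePreserving_eval (fun _ : Fin n => D) i).map_eq
  rw [e, e] at hmap
  have hYi : Integrable Y D :=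
    .of_bound hY.aestronglyMeasurable B (Filter.Eventually.of_forall hB)
  have hmeas : Measurable fun z : α × α => (inner ℝ (Y z.1) (Y z.2) : ℝ) := by fun_prop
  have : ∫ s, inner ℝ (Y (s m)) (Y (s l)) ∂(Measure.pi fun _ : Fin n => D) =
      ∫ z, inner ℝ (Y z.1) (Y z.2) ∂(D.prod D) := by
    rw [← hmap, integral_map (by fun_prop) hmeas.aestronglyMeasurable]
  rw [this, integral_prod]
  · simp_rw [integral_inner hYi, h0]
    simp
  · refine .of_bound hmeas.aestronglyMeasurable (B * B) (Filter.Eventually.of_forall fun z => ?_)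
    refine (norm_inner_le_norm _ _).trans ?_
    have := (norm_nonneg _).trans (hB z.1)
    exact mul_le_mul (hB _) (hB _) (norm_nonneg _) this

/-- Independence and centering kill the off-diagonal inner products, leaving `n` of the `n²` terms.
-/
lemma integral_norm_average_sq [CompleteSpace E] (hn : 1 ≤ n) (D : Measure α) [IsProbabilityMeasure D] {Y : α → E}
    (hY : Measurable Y) {B : ℝ} (hB : ∀ x, ‖Y x‖ ≤ B) (h0 : ∫ x, Y x ∂D = 0) :
    ∫ s, ‖average fun m => Y (s m)‖ ^ 2 ∂(Measure.pi fun _ : Fin n => D) =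
      (∫ x, ‖Y x‖ ^ 2 ∂D) / n := by
  have hn' : (n : ℝ) ≠ 0 := by positivity
  have hexp : ∀ s : Fin n → α, ‖average fun m => Y (s m)‖ ^ 2 =
      ((n : ℝ)⁻¹) ^ 2 * ∑ m, ∑ l, inner ℝ (Y (s m)) (Y (s l)) := by
    intro s
    rw [average, norm_smul, mul_pow, Real.norm_eq_abs, sq_abs, ← real_inner_self_eq_norm_sq,
      sum_inner]
    simp only [inner_sum]
  have hint : ∀ m l : Fin n, Integrable (fun s : Fin n → α => (inner ℝ (Y (s m)) (Y (s l)) : ℝ))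
      (Measure.pi fun _ : Fin n => D) := by
    intro m l
    refine .of_bound (Measurable.aestronglyMeasurable (by fun_prop)) (B * B)
      (Filter.Eventually.of_forall fun z => ?_)
    refine (norm_inner_le_norm _ _).trans ?_
    have := (norm_nonneg _).trans (hB (z m))
    exact mul_le_mul (hB _) (hB _) (norm_nonneg _) this
  simp_rw [hexp]
  rw [integral_const_mul, integral_finsetSum _ fun m _ => integrable_finsetSum _ fun l _ => hint m l]
  have : ∀ m : Fin n, ∫ s, ∑ l, inner ℝ (Y (s m)) (Y (s l)) ∂(Measure.pi fun _ : Fin n => D) =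
      ∫ x, ‖Y x‖ ^ 2 ∂D := by
    intro m
    rw [integral_finsetSum _ fun l _ => hint m l, Finset.sum_eq_single m]
    · simp_rw [real_inner_self_eq_norm_sq]
      exact integral_comp_eval (μ := fun _ : Fin n => D) (i := m) (f := fun x => ‖Y x‖ ^ 2)
        (Measurable.aestronglyMeasurable (by fun_prop))
    · intro l _ hl
      exact integral_inner_eval_eval D hY hB h0 hl.symm
    · simp
  simp_rw [this]
  simp
  field_simp

lemma integral_average_eq_zero (D : Measure α) [IsProbabilityMeasure D] {Y : α → E}
    (hY : Measurable Y) {B : ℝ} (hB : ∀ x, ‖Y x‖ ≤ B) (h0 : ∫ x, Y x ∂D = 0) :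
    ∫ s, average (fun m => Y (s m)) ∂(Measure.pi fun _ : Fin n => D) = 0 := by
  unfold average
  rw [integral_smul, integral_finsetSum]
  · have : ∀ m : Fin n, ∫ s, Y (s m) ∂(Measure.pi fun _ : Fin n => D) = 0 := fun m => by
      rw [integral_comp_eval (μ := fun _ : Fin n => D) (i := m) (f := Y) hY.aestronglyMeasurable, h0]
    simp [this]
  · intro m _
    exact .of_bound (Measurable.aestronglyMeasurable (by fun_prop)) B
      (Filter.Eventually.of_forall fun s => hB _)

/-- Bound on the expectation of the difference of centered second moments minus the correlation of
the sample-mean difference with a bounded vector `C` that does not depend on the test data. -/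
lemma abs_integral_centered_gap_le [CompleteSpace E] (hn : 1 ≤ n) (D : Measure α) [IsProbabilityMeasure D]
    (ν : Measure ((Fin n → α) × W)) [IsProbabilityMeasure ν]
    (hν : ν.map Prod.fst = Measure.pi fun _ : Fin n => D) {Y : α → E}
    (hY : Measurable Y) {B : ℝ} (hB : ∀ x, ‖Y x‖ ≤ B) (h0 : ∫ x, Y x ∂D = 0)
    {C : (Fin n → α) × W → E} (hC : Measurable C) {r : ℝ} (hCr : ∀ z, ‖C z‖ ^ 2 ≤ r) :
    Integrable (fun z : (Fin n → α) × ((Fin n → α) × W) =>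
      (n : ℝ)⁻¹ * (∑ m, ‖Y (z.1 m)‖ ^ 2 - ∑ m, ‖Y (z.2.1 m)‖ ^ 2)
        - 2 * inner ℝ (average (fun m => Y (z.1 m)) - average (fun m => Y (z.2.1 m))) (C z.2))
      ((Measure.pi fun _ : Fin n => D).prod ν) ∧
    |∫ z, ((n : ℝ)⁻¹ * (∑ m, ‖Y (z.1 m)‖ ^ 2 - ∑ m, ‖Y (z.2.1 m)‖ ^ 2)
        - 2 * inner ℝ (average (fun m => Y (z.1 m)) - average (fun m => Y (z.2.1 m))) (C z.2))
        ∂((Measure.pi fun _ : Fin n => D).prod ν)| ≤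
      (∫ x, ‖Y x‖ ^ 2 ∂D + r) / Real.sqrt n := by
  set P := Measure.pi fun _ : Fin n => D with hP
  set V := ∫ x, ‖Y x‖ ^ 2 ∂D with hV
  have hn' : (0 : ℝ) < n := by positivity
  have havg : Measurable fun s : Fin n → α => average fun m => Y (s m) := measurable_average hY
  have hsq : Measurable fun s : Fin n → α => ∑ m, ‖Y (s m)‖ ^ 2 := by fun_prop
  have hB0 : 0 ≤ B := by
    obtain ⟨x⟩ : Nonempty α := by
      by_contra h
      rw [not_nonempty_iff] at h
      exact IsProbabilityMeasure.ne_zero D (Measure.eq_zero_of_isEmpty D)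
    exact (norm_nonneg _).trans (hB x)
  have hCr' : ∀ z, ‖C z‖ ≤ Real.sqrt r := fun z => Real.le_sqrt_of_sq_le (hCr z)
  have hsqb : ∀ s : Fin n → α, ‖∑ m, ‖Y (s m)‖ ^ 2‖ ≤ n * B ^ 2 := by
    intro s
    rw [Real.norm_of_nonneg (by positivity)]
    calc _ ≤ ∑ m : Fin n, B ^ 2 := by gcongr; exact hB _
      _ = _ := by simp
  have havgb : ∀ s : Fin n → α, ‖average fun m => Y (s m)‖ ≤ B := fun s =>
    norm_average_le hB0 fun m => hB _
  have i_sq : Integrable (fun s : Fin n → α => ∑ m, ‖Y (s m)‖ ^ 2) P :=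
    .of_bound hsq.aestronglyMeasurable _ (Filter.Eventually.of_forall hsqb)
  have i_avg : Integrable (fun s : Fin n → α => average fun m => Y (s m)) P :=
    .of_bound havg.aestronglyMeasurable _ (Filter.Eventually.of_forall havgb)
  have i_avg_sq : Integrable (fun s : Fin n → α => ‖average fun m => Y (s m)‖ ^ 2) P := by
    refine .of_bound (havg.norm.pow_const 2).aestronglyMeasurable (B ^ 2)
      (Filter.Eventually.of_forall fun s => ?_)
    rw [Real.norm_of_nonneg (by positivity)]
    gcongr
    exact havgb s
  have mp : MeasurePreserving Prod.fst ν P := ⟨measurable_fst, hν⟩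
  have e_sq : ∫ s, ∑ m, ‖Y (s m)‖ ^ 2 ∂P = n * V := by
    rw [integral_finsetSum]
    · have : ∀ m : Fin n, ∫ s, ‖Y (s m)‖ ^ 2 ∂P = V := fun m =>
        integral_comp_eval (μ := fun _ : Fin n => D) (i := m) (f := fun x => ‖Y x‖ ^ 2)
          (Measurable.aestronglyMeasurable (by fun_prop))
      simp [this]
    · intro m _
      refine .of_bound (Measurable.aestronglyMeasurable (by fun_prop)) (B ^ 2)
        (Filter.Eventually.of_forall fun s => ?_)
      rw [Real.norm_of_nonneg (by positivity)]
      gcongr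
      exact hB _
  have comp : ∀ {f : (Fin n → α) → ℝ}, Measurable f → ∫ z, f z.1 ∂ν = ∫ s, f s ∂P := by
    intro f hf
    rw [← hν, integral_map measurable_fst.aemeasurable hf.aestronglyMeasurable]
  have i_inner : Integrable (fun z : (Fin n → α) × W =>
      (inner ℝ (average (fun m => Y (z.1 m))) (C z) : ℝ)) ν := by
    refine .of_bound (Measurable.aestronglyMeasurable
      ((havg.comp measurable_fst).inner hC)) (B * Real.sqrt r)
      (Filter.Eventually.of_forall fun z => ?_)
    exact (norm_inner_le_norm _ _).trans (mul_le_mul (havgb _) (hCr' _) (norm_nonneg _) hB0)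
  set G : (Fin n → α) × ((Fin n → α) × W) → ℝ := fun z =>
    (n : ℝ)⁻¹ * (∑ m, ‖Y (z.1 m)‖ ^ 2 - ∑ m, ‖Y (z.2.1 m)‖ ^ 2)
        - 2 * inner ℝ (average (fun m => Y (z.1 m)) - average (fun m => Y (z.2.1 m))) (C z.2)
    with hG
  have hGm : Measurable G := by
    refine Measurable.sub (measurable_const.mul ((hsq.comp measurable_fst).sub
      (hsq.comp (measurable_fst.comp measurable_snd)))) (measurable_const.mul (Measurable.inner
        ((havg.comp measurable_fst).sub (havg.comp (measurable_fst.comp measurable_snd)))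
        (hC.comp measurable_snd)))
  have hGi : Integrable G (P.prod ν) := by
    refine .of_bound hGm.aestronglyMeasurable
      ((n : ℝ)⁻¹ * (n * B ^ 2 + n * B ^ 2) + 2 * ((B + B) * Real.sqrt r))
      (Filter.Eventually.of_forall fun z => ?_)
    refine (norm_sub_le _ _).trans (add_le_add ?_ ?_)
    · rw [norm_mul, Real.norm_of_nonneg (by positivity : (0 : ℝ) ≤ (n : ℝ)⁻¹)]
      gcongr
      exact (norm_sub_le _ _).trans (add_le_add (hsqb _) (hsqb _))
    · rw [norm_mul, Real.norm_of_nonneg (by positivity : (0 : ℝ) ≤ 2)]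
      gcongr
      refine (norm_inner_le_norm _ _).trans (mul_le_mul ?_ (hCr' _) (norm_nonneg _) (by positivity))
      exact (norm_sub_le _ _).trans (add_le_add (havgb _) (havgb _))
  refine ⟨hGi, ?_⟩
  rw [integral_prod_symm _ hGi]
  have inner_int : ∀ z : (Fin n → α) × W, ∫ a, G (a, z) ∂P =
      V - (n : ℝ)⁻¹ * ∑ m, ‖Y (z.1 m)‖ ^ 2 + 2 * inner ℝ (average (fun m => Y (z.1 m))) (C z) := by
    intro z
    -- The test average is centered and `C z` is constant for fixed training data and parameters.
    have hz : ∫ a, inner ℝ (average (fun m => Y (a m))) (C z) ∂P = (0 : ℝ) := by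
      simp_rw [real_inner_comm (C z)]
      rw [integral_inner i_avg, integral_average_eq_zero D hY hB h0, inner_zero_right]
    have iz : Integrable (fun a => (inner ℝ (average (fun m => Y (a m))) (C z) : ℝ)) P :=
      i_avg.inner_const _
    have : ∀ a, G (a, z) = (n : ℝ)⁻¹ * ∑ m, ‖Y (a m)‖ ^ 2
        - 2 * inner ℝ (average (fun m => Y (a m))) (C z)
        + (2 * inner ℝ (average (fun m => Y (z.1 m))) (C z)
          - (n : ℝ)⁻¹ * ∑ m, ‖Y (z.1 m)‖ ^ 2) := by
      intro a
      simp only [hG, inner_sub_left]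
      ring
    have isub : Integrable (fun a : Fin n → α => (n : ℝ)⁻¹ * ∑ m, ‖Y (a m)‖ ^ 2
        - 2 * inner ℝ (average (fun m => Y (a m))) (C z)) P :=
      (i_sq.const_mul _).sub (iz.const_mul _)
    simp_rw [this]
    rw [integral_add isub (integrable_const _),
      integral_sub (i_sq.const_mul _) (iz.const_mul _), integral_const_mul, integral_const_mul,
      e_sq, hz, integral_const, probReal_univ, one_smul]
    field_simp
    ring
  simp_rw [inner_int]
  have i_sq' : Integrable (fun z : (Fin n → α) × W => ∑ m, ‖Y (z.1 m)‖ ^ 2) ν :=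
    mp.integrable_comp_of_integrable i_sq
  have i_avg_sq' : Integrable (fun z : (Fin n → α) × W => ‖average fun m => Y (z.1 m)‖ ^ 2) ν :=
    mp.integrable_comp_of_integrable i_avg_sq
  have isub : Integrable (fun z : (Fin n → α) × W => V - (n : ℝ)⁻¹ * ∑ m, ‖Y (z.1 m)‖ ^ 2) ν :=
    (integrable_const _).sub (i_sq'.const_mul _)
  rw [integral_add isub (i_inner.const_mul _),
    integral_sub (integrable_const _) (i_sq'.const_mul _), integral_const_mul, comp hsq, e_sq,
    integral_const, probReal_univ, one_smul, inv_mul_cancel_left₀ hn'.ne', sub_self, zero_add,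
    ← Real.norm_eq_abs]
  refine (norm_integral_le_integral_norm _).trans ?_
  calc ∫ z, ‖2 * (inner ℝ (average (fun m => Y (z.1 m))) (C z) : ℝ)‖ ∂ν
      ≤ ∫ z, (Real.sqrt n * ‖average fun m => Y (z.1 m)‖ ^ 2 + r / Real.sqrt n) ∂ν := by
        refine integral_mono (i_inner.const_mul _).norm
          ((i_avg_sq'.const_mul _).add (integrable_const _)) fun z => ?_
        dsimp only
        rw [norm_mul, Real.norm_of_nonneg (by positivity : (0 : ℝ) ≤ 2)]
        have h1 := norm_inner_le_norm (𝕜 := ℝ) (average fun m => Y (z.1 m)) (C z)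
        set u := ‖average fun m => Y (z.1 m)‖
        -- The weight `√n` balances the two terms, since `u²` has expectation `V / n`.
        have h2 : 2 * (u * ‖C z‖) ≤ Real.sqrt n * u ^ 2 + ‖C z‖ ^ 2 / Real.sqrt n := by
          have := sq_nonneg (Real.sqrt n * u - ‖C z‖)
          rw [← sub_nonneg]
          have e : Real.sqrt n * u ^ 2 + ‖C z‖ ^ 2 / Real.sqrt n - 2 * (u * ‖C z‖) =
              (Real.sqrt n * u - ‖C z‖) ^ 2 / Real.sqrt n := by
            field_simp
            ring
          rw [e]
          positivity
        have h3 : ‖C z‖ ^ 2 / Real.sqrt n ≤ r / Real.sqrt n := by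
          gcongr
          exact hCr z
        linarith
    _ = _ := by
        rw [integral_add (i_avg_sq'.const_mul _) (integrable_const _), integral_const_mul,
          comp (havg.norm.pow_const 2), integral_norm_average_sq hn D hY hB h0, integral_const,
          probReal_univ, one_smul, add_div, ← hV]
        congr 1
        nth_rewrite 2 [← Real.sq_sqrt hn'.le]
        field_simp

end

/-! ### From kernels to mass functions and exchangeability -/

section

variable {d dz dφ dθ K n : ℕ}
  {𝒳 : Set (EuclideanSpace ℝ (Fin d))} {𝒵 : Set (EuclideanSpace ℝ (Fin dz))}
  {Φ : Set (EuclideanSpace ℝ (Fin dφ))} {Θ : Set (EuclideanSpace ℝ (Fin dθ))}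

/-- Mass functions of the latent indices of the data points `x i`. -/
def indexMass {N : ℕ} (enc : Kernel (EncParam K 𝒵 Φ × 𝒳) (Fin K)) (p : EncParam K 𝒵 Φ)
    (x : Fin N → 𝒳) (i : Fin N) (j : Fin K) : ℝ :=
  (enc (p, x i)).real {j}

lemma indexMass_nonneg {N : ℕ} (enc : Kernel (EncParam K 𝒵 Φ × 𝒳) (Fin K))
    (p : EncParam K 𝒵 Φ) (x : Fin N → 𝒳) (i : Fin N) (j : Fin K) : 0 ≤ indexMass enc p x i j :=
  measureReal_nonneg

lemma sum_indexMass {N : ℕ} (enc : Kernel (EncParam K 𝒵 Φ × 𝒳) (Fin K)) [IsMarkovKernel enc]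
    (p : EncParam K 𝒵 Φ) (x : Fin N → 𝒳) (i : Fin N) : ∑ j, indexMass enc p x i j = 1 := by
  simp [indexMass]

lemma measurable_indexMass {N : ℕ} (enc : Kernel (EncParam K 𝒵 Φ × 𝒳) (Fin K)) (i : Fin N)
    (j : Fin K) :
    Measurable fun z : EncParam K 𝒵 Φ × (Fin N → 𝒳) => indexMass enc z.1 z.2 i j := by
  have h : Measurable fun y => (enc y).real {j} :=
    (enc.measurable_coe (measurableSet_singleton j)).ennreal_toReal
  exact h.comp (g := fun y => (enc y).real {j})
    (measurable_fst.prodMk ((measurable_pi_apply i).comp measurable_snd))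

lemma measurable_permEntropy_indexMass {N : ℕ} (enc : Kernel (EncParam K 𝒵 Φ × 𝒳) (Fin K)) :
    Measurable fun z : EncParam K 𝒵 Φ × (Fin N → 𝒳) => permEntropy (indexMass enc z.1 z.2) := by
  have := measurable_indexMass (N := N) enc
  unfold permEntropy permMass prodMass
  fun_prop

instance (enc : Kernel (EncParam K 𝒵 Φ × 𝒳) (Fin K)) [IsMarkovKernel enc]
    (p : EncParam K 𝒵 Φ) (s : Fin n → 𝒳) : IsProbabilityMeasure (indexLaw enc p s) := by
  unfold indexLaw; infer_instance

instance (enc : Kernel (EncParam K 𝒵 Φ × 𝒳) (Fin K)) [IsMarkovKernel enc]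
    (p : EncParam K 𝒵 Φ) (x : Fin (n + n) → 𝒳) (T : Equiv.Perm (Fin (n + n))) :
    IsProbabilityMeasure (jointPosterior enc p x T) := by
  unfold jointPosterior; infer_instance

instance (enc : Kernel (EncParam K 𝒵 Φ × 𝒳) (Fin K)) [IsMarkovKernel enc]
    (p : EncParam K 𝒵 Φ) (x : Fin (n + n) → 𝒳) : IsProbabilityMeasure (permPrior enc p x) := by
  refine ⟨?_⟩
  have h : ((Nat.factorial (n + n) : ℕ) : ℝ≥0∞) ≠ 0 := by exact_mod_cast Nat.factorial_ne_zero _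
  simp only [permPrior, Measure.smul_apply, Measure.coe_finsetSum, Finset.sum_apply, measure_univ,
    Finset.sum_const, Finset.card_univ, Fintype.card_perm, Fintype.card_fin, smul_eq_mul,
    nsmul_eq_mul, mul_one]
  exact ENNReal.inv_mul_cancel h (ENNReal.natCast_ne_top _)

lemma jointPosterior_absolutelyContinuous (enc : Kernel (EncParam K 𝒵 Φ × 𝒳) (Fin K))
    (p : EncParam K 𝒵 Φ) (x : Fin (n + n) → 𝒳) (T : Equiv.Perm (Fin (n + n))) :
    jointPosterior enc p x T ≪ permPrior enc p x := by
  intro s hs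
  simp only [permPrior, Measure.smul_apply, Measure.coe_finsetSum, Finset.sum_apply, smul_eq_mul,
    mul_eq_zero, ENNReal.inv_eq_zero, ENNReal.natCast_ne_top, false_or,
    Finset.sum_eq_zero_iff] at hs
  exact hs T (Finset.mem_univ T)

lemma jointPosterior_real_singleton (enc : Kernel (EncParam K 𝒵 Φ × 𝒳) (Fin K))
    [IsMarkovKernel enc] (p : EncParam K 𝒵 Φ) (x : Fin (n + n) → 𝒳)
    (T : Equiv.Perm (Fin (n + n))) (ω : (Fin n → Fin K) × (Fin n → Fin K)) :
    (jointPosterior enc p x T).real {ω} =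
      prodMass (indexMass enc p (x ∘ T)) (Fin.appendEquiv n n ω) := by
  obtain ⟨u, v⟩ := ω
  rw [jointPosterior, ← Set.singleton_prod_singleton, measureReal_prod_prod, indexLaw, indexLaw,
    measureReal_def, measureReal_def, Measure.pi_singleton, Measure.pi_singleton,
    ENNReal.toReal_prod, ENNReal.toReal_prod, prodMass, Fin.prod_univ_add]
  simp only [indexMass, Fin.appendEquiv, Equiv.coe_fn_mk, Fin.append_left, Fin.append_right]
  rfl

/-- Left translation by `T` permutes the summands of the prior, so `x` may be replaced by `x ∘ T`;
posterior and prior are then expressed through the same mass functions. -/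
lemma permPrior_real_singleton (enc : Kernel (EncParam K 𝒵 Φ × 𝒳) (Fin K))
    [IsMarkovKernel enc] (p : EncParam K 𝒵 Φ) (x : Fin (n + n) → 𝒳)
    (T : Equiv.Perm (Fin (n + n))) (ω : (Fin n → Fin K) × (Fin n → Fin K)) :
    (permPrior enc p x).real {ω} =
      permMass (indexMass enc p (x ∘ T)) (Fin.appendEquiv n n ω) := by
  rw [permPrior, measureReal_ennreal_smul_apply, ENNReal.toReal_inv, ENNReal.toReal_natCast,
    permMass, ← Equiv.sum_comp (Equiv.mulLeft T)]
  congr 1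
  rw [measureReal_def, Measure.coe_finsetSum, Finset.sum_apply,
    ENNReal.toReal_sum fun _ _ => measure_ne_top _ _]
  exact Finset.sum_congr rfl fun T' _ => jointPosterior_real_singleton enc p x (T * T') ω

lemma klDiv_jointPosterior (enc : Kernel (EncParam K 𝒵 Φ × 𝒳) (Fin K))
    [IsMarkovKernel enc] (p : EncParam K 𝒵 Φ) (x : Fin (n + n) → 𝒳)
    (T : Equiv.Perm (Fin (n + n))) :
    InformationTheory.klDiv (jointPosterior enc p x T) (permPrior enc p x) =
      ENNReal.ofReal (permEntropy (indexMass enc p (x ∘ T))) := by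
  rw [klDiv_eq_ofReal_sum _ _ (jointPosterior_absolutelyContinuous enc p x T), permEntropy,
    ← Equiv.sum_comp (Fin.appendEquiv n n)]
  simp_rw [jointPosterior_real_singleton, permPrior_real_singleton enc p x T]

/-- Joint law of the test data, the training data and the learned parameters. -/
noncomputable def trainTestLaw (D : Measure 𝒳) (alg : Kernel (Fin n → 𝒳) (Param K 𝒵 Φ Θ)) :
    Measure ((Fin n → 𝒳) × ((Fin n → 𝒳) × Param K 𝒵 Φ Θ)) :=
  (Measure.pi fun _ : Fin n => D).prod ((Measure.pi fun _ : Fin n => D) ⊗ₘ alg)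

instance (D : Measure 𝒳) [IsProbabilityMeasure D] (alg : Kernel (Fin n → 𝒳) (Param K 𝒵 Φ Θ))
    [IsMarkovKernel alg] : IsProbabilityMeasure (trainTestLaw D alg) := by
  unfold trainTestLaw; infer_instance

lemma measurePreserving_append (D : Measure 𝒳) [IsProbabilityMeasure D] :
    MeasurePreserving (fun z : (Fin n → 𝒳) × (Fin n → 𝒳) => Fin.append z.1 z.2)
      ((Measure.pi fun _ : Fin n => D).prod (Measure.pi fun _ : Fin n => D))
      (Measure.pi fun _ : Fin (n + n) => D) := by
  have hm : Measurable fun z : (Fin n → 𝒳) × (Fin n → 𝒳) => Fin.append z.1 z.2 := by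
    rw [measurable_pi_iff]
    intro i
    induction i using Fin.addCases with
    | left m => simp only [Fin.append_left]; fun_prop
    | right m => simp only [Fin.append_right]; fun_prop
  refine ⟨hm, (Measure.pi_eq fun s hs => ?_).symm⟩
  rw [Measure.map_apply hm (MeasurableSet.univ_pi hs)]
  have : (fun z : (Fin n → 𝒳) × (Fin n → 𝒳) => Fin.append z.1 z.2) ⁻¹' Set.univ.pi s =
      (Set.univ.pi fun m => s (Fin.castAdd n m)) ×ˢ (Set.univ.pi fun m => s (Fin.natAdd n m)) := by
    ext z
    simp only [Set.mem_preimage, Set.mem_univ_pi, Set.mem_prod]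
    constructor
    · intro h
      exact ⟨fun m => by simpa only [Fin.append_left] using h (Fin.castAdd n m),
        fun m => by simpa only [Fin.append_right] using h (Fin.natAdd n m)⟩
    · rintro ⟨h1, h2⟩ i
      induction i using Fin.addCases with
      | left m => simpa only [Fin.append_left] using h1 m
      | right m => simpa only [Fin.append_right] using h2 m
  rw [this, Measure.prod_prod, Measure.pi_pi, Measure.pi_pi, Fin.prod_univ_add]

lemma measurePreserving_comp_perm (D : Measure 𝒳) [IsProbabilityMeasure D] {N : ℕ}
    (T : Equiv.Perm (Fin N)) :
    MeasurePreserving (fun x : Fin N → 𝒳 => x ∘ T)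
      (Measure.pi fun _ : Fin N => D) (Measure.pi fun _ : Fin N => D) :=
  measurePreserving_arrowCongr' (fun _ : Fin N => D) (fun _ => D) T.symm (MeasurableEquiv.refl 𝒳)
    fun _ => MeasurePreserving.id D

/-- The expected divergence as an integral of a finite relative entropy, by exchangeability of the
supersample. -/
lemma expectedKL_eq (D : Measure 𝒳) [IsProbabilityMeasure D]
    (enc : Kernel (EncParam K 𝒵 Φ × 𝒳) (Fin K)) [IsMarkovKernel enc]
    (alg : Kernel (Fin n → 𝒳) (Param K 𝒵 Φ Θ)) [IsMarkovKernel alg] :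
    expectedKL D enc alg = ∫⁻ z, ENNReal.ofReal
      (permEntropy (indexMass enc z.2.2.1 (Fin.append z.1 z.2.1))) ∂(trainTestLaw D alg) := by
  have hent := measurable_permEntropy_indexMass (N := n + n) enc
  have htrain : Measurable fun x : Fin (n + n) → 𝒳 => trainData 1 x := by
    unfold trainData; fun_prop
  let F : (Fin (n + n) → 𝒳) → ℝ≥0∞ := fun x =>
    ∫⁻ w, ENNReal.ofReal (permEntropy (indexMass enc w.1 x)) ∂(alg (trainData 1 x))
  have hF : Measurable F := by
    have hφ : Measurable fun z : (Fin (n + n) → 𝒳) × Param K 𝒵 Φ Θ => (z.2.1, z.1) := by fun_prop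
    have hψ : Measurable fun z : (Fin (n + n) → 𝒳) × Param K 𝒵 Φ Θ =>
        ENNReal.ofReal (permEntropy (indexMass enc z.2.1 z.1)) := (hent.comp hφ).ennreal_ofReal
    exact Measurable.lintegral_kernel_prod_right' (κ := alg.comap _ htrain) hψ
  -- The permutation enters only through `x ∘ T`, whose law is that of `x`; hence all `(2n)!` terms
  -- have the same integral.
  have h1 : ∀ (x : Fin (n + n) → 𝒳) (T : Equiv.Perm (Fin (n + n))),
      ∫⁻ p, InformationTheory.klDiv (jointPosterior enc p x T) (permPrior enc p x)
        ∂(alg.fst (trainData T x)) = F (x ∘ T) := by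
    intro x T
    simp_rw [klDiv_jointPosterior]
    rw [Kernel.lintegral_fst]
    · rfl
    · have hφ : Measurable fun p : EncParam K 𝒵 Φ => (p, x ∘ T) := measurable_prodMk_right
      exact (hent.comp hφ).ennreal_ofReal
  have hfac : ((Nat.factorial (n + n) : ℕ) : ℝ≥0∞) ≠ 0 := by
    exact_mod_cast Nat.factorial_ne_zero _
  have hFa : Measurable fun z : (Fin n → 𝒳) × (Fin n → 𝒳) => F (Fin.append z.1 z.2) :=
    hF.comp (measurePreserving_append D).measurable
  rw [expectedKL]
  simp_rw [h1]
  have hFT : ∀ T : Equiv.Perm (Fin (n + n)), Measurable fun x : Fin (n + n) → 𝒳 => F (x ∘ T) :=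
    fun T => hF.comp (measurePreserving_comp_perm D T).measurable
  rw [lintegral_const_mul _ (Finset.measurable_fun_sum _ fun T _ => hFT T),
    lintegral_finsetSum _ fun T _ => hFT T]
  have h2 : ∀ T : Equiv.Perm (Fin (n + n)), ∫⁻ x, F (x ∘ T) ∂(Measure.pi fun _ => D) =
      ∫⁻ x, F x ∂(Measure.pi fun _ => D) := fun T =>
    (measurePreserving_comp_perm D T).lintegral_comp hF
  simp_rw [h2]
  rw [Finset.sum_const, Finset.card_univ, Fintype.card_perm, Fintype.card_fin, nsmul_eq_mul,
    ← mul_assoc, ENNReal.inv_mul_cancel hfac (ENNReal.natCast_ne_top _), one_mul,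
    ← (measurePreserving_append D).lintegral_comp hF, lintegral_prod _ hFa.aemeasurable,
    trainTestLaw]
  have happ : Measurable fun z : (Fin n → 𝒳) × ((Fin n → 𝒳) × Param K 𝒵 Φ Θ) =>
      Fin.append z.1 z.2.1 :=
    (measurePreserving_append D).measurable.comp
      (measurable_fst.prodMk (measurable_fst.comp measurable_snd))
  have hφ : Measurable fun z : (Fin n → 𝒳) × ((Fin n → 𝒳) × Param K 𝒵 Φ Θ) =>
      (z.2.2.1, Fin.append z.1 z.2.1) := Measurable.prodMk (by fun_prop) happ
  have hz : Measurable fun z : (Fin n → 𝒳) × ((Fin n → 𝒳) × Param K 𝒵 Φ Θ) =>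
      ENNReal.ofReal (permEntropy (indexMass enc z.2.2.1 (Fin.append z.1 z.2.1))) :=
    (hent.comp hφ).ennreal_ofReal
  rw [lintegral_prod _ hz.aemeasurable]
  refine lintegral_congr fun a => ?_
  refine Eq.trans ?_ (Measure.lintegral_compProd (hz.comp measurable_prodMk_left)).symm
  refine lintegral_congr fun b => ?_
  have : trainData 1 (Fin.append a b) = b := by
    ext1 m
    simp only [trainData, Equiv.Perm.coe_one, id_eq, Fin.append_right]
  simp only [F, this, Function.comp_apply]

lemma expectedLoss_eq_sum (enc : Kernel (EncParam K 𝒵 Φ × 𝒳) (Fin K)) [IsMarkovKernel enc]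
    (g : Θ → 𝒵 → 𝒳) (w : Param K 𝒵 Φ Θ) (x : 𝒳) :
    expectedLoss enc g w x = ∑ j, (enc (w.1, x)).real {j} *
      ‖(x : EuclideanSpace ℝ (Fin d)) - (g w.2 (w.1.1 j) : EuclideanSpace ℝ (Fin d))‖ ^ 2 := by
  rw [expectedLoss, integral_fintype Integrable.of_finite]
  simp only [smul_eq_mul]

lemma meanLoss_indexMass (enc : Kernel (EncParam K 𝒵 Φ × 𝒳) (Fin K)) [IsMarkovKernel enc]
    (g : Θ → 𝒵 → 𝒳) (w : Param K 𝒵 Φ Θ) (s : Fin n → 𝒳) :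
    meanLoss (indexMass enc w.1 s) (fun m => (s m : EuclideanSpace ℝ (Fin d)))
      (fun j => (g w.2 (w.1.1 j) : EuclideanSpace ℝ (Fin d))) =
      (n : ℝ)⁻¹ * ∑ m, expectedLoss enc g w (s m) := by
  simp_rw [expectedLoss_eq_sum]
  rfl

lemma measurable_center {g : Θ → 𝒵 → 𝒳} (hg : Measurable (Function.uncurry g)) (j : Fin K) :
    Measurable fun w : Param K 𝒵 Φ Θ => (g w.2 (w.1.1 j) : EuclideanSpace ℝ (Fin d)) := by
  have : Measurable fun w : Param K 𝒵 Φ Θ => (w.2, w.1.1 j) := by fun_prop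
  exact measurable_subtype_coe.comp (hg.comp this)

lemma measurable_expectedLoss (enc : Kernel (EncParam K 𝒵 Φ × 𝒳) (Fin K)) [IsMarkovKernel enc]
    {g : Θ → 𝒵 → 𝒳} (hg : Measurable (Function.uncurry g)) :
    Measurable fun z : Param K 𝒵 Φ Θ × 𝒳 => expectedLoss enc g z.1 z.2 := by
  simp_rw [expectedLoss_eq_sum]
  refine Finset.measurable_fun_sum _ fun j _ => ?_
  have h : Measurable fun y => (enc y).real {j} :=
    (enc.measurable_coe (measurableSet_singleton j)).ennreal_toReal
  have h1 : Measurable fun z : Param K 𝒵 Φ Θ × 𝒳 => (enc (z.1.1, z.2)).real {j} :=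
    h.comp (g := fun y => (enc y).real {j}) (by fun_prop)
  have h2 : Measurable fun z : Param K 𝒵 Φ Θ × 𝒳 =>
      (g z.1.2 (z.1.1.1 j) : EuclideanSpace ℝ (Fin d)) := (measurable_center hg j).comp measurable_fst
  fun_prop

lemma expectedLoss_mem_Icc (enc : Kernel (EncParam K 𝒵 Φ × 𝒳) (Fin K)) [IsMarkovKernel enc]
    (g : Θ → 𝒵 → 𝒳) {Δ : ℝ} (hΔ : ∀ x y : 𝒳, ‖(x : EuclideanSpace ℝ (Fin d)) - y‖ ^ 2 ≤ Δ)
    (w : Param K 𝒵 Φ Θ) (x : 𝒳) : expectedLoss enc g w x ∈ Set.Icc 0 Δ := by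
  refine ⟨integral_nonneg fun j => by positivity, ?_⟩
  rw [expectedLoss]
  refine (integral_mono (g := fun _ => Δ) Integrable.of_finite Integrable.of_finite
    fun j => hΔ _ _).trans_eq ?_
  simp

lemma sq_norm_sub_le {Δ : ℝ} (h : DiamLT 𝒳 Δ) (x y : 𝒳) :
    ‖(x : EuclideanSpace ℝ (Fin d)) - y‖ ^ 2 ≤ Δ := by
  have h1 := (Metric.edist_le_ediam_of_mem x.2 y.2).trans h.2.le
  rw [edist_dist, ENNReal.ofReal_le_ofReal_iff (Real.sqrt_nonneg _), dist_eq_norm] at h1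
  calc _ ≤ Real.sqrt Δ ^ 2 := by gcongr
    _ = Δ := Real.sq_sqrt h.1.le

/-- The generalization error as a single expectation of the test–training loss difference. -/
lemma genError_eq (hn : 1 ≤ n) (D : Measure 𝒳) [IsProbabilityMeasure D]
    (enc : Kernel (EncParam K 𝒵 Φ × 𝒳) (Fin K)) [IsMarkovKernel enc]
    {g : Θ → 𝒵 → 𝒳} (hg : Measurable (Function.uncurry g))
    (alg : Kernel (Fin n → 𝒳) (Param K 𝒵 Φ Θ)) [IsMarkovKernel alg] {Δ : ℝ}
    (hΔ : ∀ x y : 𝒳, ‖(x : EuclideanSpace ℝ (Fin d)) - y‖ ^ 2 ≤ Δ) :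
    Integrable (fun z : (Fin n → 𝒳) × ((Fin n → 𝒳) × Param K 𝒵 Φ Θ) =>
      (n : ℝ)⁻¹ * ∑ m, expectedLoss enc g z.2.2 (z.1 m)
        - (n : ℝ)⁻¹ * ∑ m, expectedLoss enc g z.2.2 (z.2.1 m)) (trainTestLaw D alg) ∧
    genError D enc g alg = |∫ z, ((n : ℝ)⁻¹ * ∑ m, expectedLoss enc g z.2.2 (z.1 m)
      - (n : ℝ)⁻¹ * ∑ m, expectedLoss enc g z.2.2 (z.2.1 m)) ∂(trainTestLaw D alg)| := by
  have hn' : (n : ℝ) ≠ 0 := by positivity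
  have hl := measurable_expectedLoss enc hg
  have hlb : ∀ w x, ‖expectedLoss enc g w x‖ ≤ Δ := fun w x => by
    have := expectedLoss_mem_Icc enc g hΔ w x
    rw [Real.norm_of_nonneg this.1]
    exact this.2
  set L : (Fin n → 𝒳) → Param K 𝒵 Φ Θ → ℝ := fun s w =>
    (n : ℝ)⁻¹ * ∑ m, expectedLoss enc g w (s m) with hL
  have hLm : Measurable fun z : (Fin n → 𝒳) × Param K 𝒵 Φ Θ => L z.1 z.2 := by
    refine measurable_const.mul (Finset.measurable_fun_sum _ fun m _ => ?_)
    have hφ : Measurable fun z : (Fin n → 𝒳) × Param K 𝒵 Φ Θ => (z.2, z.1 m) := by fun_prop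
    exact hl.comp hφ
  have hLb : ∀ s w, ‖L s w‖ ≤ Δ := by
    intro s w
    rw [hL, norm_mul, norm_inv, Real.norm_natCast, inv_mul_le_iff₀ (by positivity)]
    refine (norm_sum_le _ _).trans ?_
    simpa using Finset.sum_le_sum fun m (_ : m ∈ Finset.univ) => hlb w (s m)
  have hGm : Measurable fun z : (Fin n → 𝒳) × ((Fin n → 𝒳) × Param K 𝒵 Φ Θ) =>
      L z.1 z.2.2 - L z.2.1 z.2.2 :=
    (hLm.comp (measurable_fst.prodMk (measurable_snd.comp measurable_snd))).sub
      (hLm.comp measurable_snd)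
  have hGi : Integrable (fun z : (Fin n → 𝒳) × ((Fin n → 𝒳) × Param K 𝒵 Φ Θ) =>
      L z.1 z.2.2 - L z.2.1 z.2.2) (trainTestLaw D alg) :=
    .of_bound hGm.aestronglyMeasurable (Δ + Δ) (Filter.Eventually.of_forall fun z =>
      (norm_sub_le _ _).trans (add_le_add (hLb _ _) (hLb _ _)))
  refine ⟨hGi, ?_⟩
  rw [genError]
  congr 1
  set P := Measure.pi fun _ : Fin n => D with hP
  let R : Param K 𝒵 Φ Θ → ℝ := fun w => ∫ x, expectedLoss enc g w x ∂D
  have hlw : ∀ w, Measurable (expectedLoss enc g w) := fun w => hl.comp measurable_prodMk_left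
  have hRL : ∀ w, ∫ a, L a w ∂P = R w := by
    intro w
    simp only [hL]
    rw [integral_const_mul, integral_finsetSum]
    · have : ∀ m : Fin n, ∫ a, expectedLoss enc g w (a m) ∂P = R w := fun m =>
        integral_comp_eval (μ := fun _ : Fin n => D) (i := m) (f := expectedLoss enc g w)
          (hlw w).aestronglyMeasurable
      simp only [this]
      simp
      field_simp
    · intro m _
      exact .of_bound ((hlw w).comp (measurable_pi_apply m)).aestronglyMeasurable Δ
        (Filter.Eventually.of_forall fun a => hlb _ _)
  have hinner : ∀ z : (Fin n → 𝒳) × Param K 𝒵 Φ Θ, ∫ a, (L a z.2 - L z.1 z.2) ∂P =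
      R z.2 - L z.1 z.2 := by
    intro z
    rw [integral_sub _ (integrable_const _), hRL, integral_const, probReal_univ, one_smul]
    exact .of_bound (hLm.comp (measurable_id.prodMk measurable_const)).aestronglyMeasurable Δ
      (Filter.Eventually.of_forall fun a => hLb _ _)
  have hRm : Measurable R := by
    have := hl.stronglyMeasurable.integral_prod_right' (ν := D)
    exact this.measurable
  have hRb : ∀ w, ‖R w‖ ≤ Δ := fun w => by
    simpa using norm_integral_le_of_norm_le_const (μ := D)
      (Filter.Eventually.of_forall fun x => hlb w x)
  have hRi : Integrable (fun z : (Fin n → 𝒳) × Param K 𝒵 Φ Θ => R z.2 - L z.1 z.2)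
      (P ⊗ₘ alg) :=
    .of_bound ((hRm.comp measurable_snd).sub hLm).aestronglyMeasurable (Δ + Δ)
      (Filter.Eventually.of_forall fun z =>
        (norm_sub_le _ _).trans (add_le_add (hRb _) (hLb _ _)))
  refine Eq.trans ?_ (integral_prod_symm _ hGi).symm
  refine Eq.trans ?_ (integral_congr_ae (Filter.Eventually.of_forall fun z => (hinner z).symm))
  rw [Measure.integral_compProd hRi]
  refine integral_congr_ae (Filter.Eventually.of_forall fun s => ?_)
  simp only
  have hi : Integrable (fun z : 𝒳 × Param K 𝒵 Φ Θ => expectedLoss enc g z.2 z.1 - L s z.2)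
      (D.prod (alg s)) := by
    refine .of_bound (Measurable.aestronglyMeasurable ((hl.comp measurable_swap).sub
      (hLm.comp (measurable_const.prodMk measurable_snd)))) (Δ + Δ)
      (Filter.Eventually.of_forall fun z =>
        (norm_sub_le _ _).trans (add_le_add (hlb _ _) (hLb _ _)))
  have e : ∀ x w, expectedLoss enc g w x - 1 / (n : ℝ) * ∑ m, expectedLoss enc g w (s m) =
      expectedLoss enc g w x - L s w := fun x w => by rw [hL, one_div]
  simp_rw [e]
  rw [integral_integral_swap hi]
  refine integral_congr_ae (Filter.Eventually.of_forall fun w => ?_)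
  simp only
  rw [integral_sub _ (integrable_const _), integral_const, probReal_univ, one_smul]
  exact .of_bound (hlw w).aestronglyMeasurable Δ (Filter.Eventually.of_forall fun x => hlb _ _)

end

/-! ### Optimisation in `t`, bias-variance, and assembly -/

section

lemma le_of_forall_le_div_add_mul {A k Δ N : ℝ} (hk : 0 ≤ k) (hΔ : 0 < Δ) (hN : 0 < N)
    (h : ∀ t : ℝ, 0 < t → A ≤ k / t + t * Δ ^ 2 / N) : A ≤ 2 * Δ * Real.sqrt (k / N) := by
  set s := Real.sqrt (k / N) with hs
  have hs0 : 0 ≤ s := Real.sqrt_nonneg _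
  have hk' : k = N * s ^ 2 := by
    rw [hs, Real.sq_sqrt (by positivity)]; field_simp
  refine le_of_forall_pos_le_add fun ε hε => ?_
  have hε' : 0 < ε / Δ := by positivity
  -- For `ε = 0` this is the minimiser `√(k N) / Δ`; the shift keeps it positive when `k = 0`.
  have h1 := h (N * (s + ε / Δ) / Δ) (by positivity)
  have e1 : N * (s + ε / Δ) / Δ * Δ ^ 2 / N = Δ * s + ε := by field_simp
  have e2 : k / (N * (s + ε / Δ) / Δ) ≤ Δ * s := by
    rw [hk', div_le_iff₀ (by positivity)]
    have : Δ * s * (N * (s + ε / Δ) / Δ) = N * s ^ 2 + N * s * (ε / Δ) := by field_simp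
    rw [this]
    have : 0 ≤ N * s * (ε / Δ) := by positivity
    linarith
  linarith

lemma meanLoss_sub_const {E κ : Type*} [NormedAddCommGroup E] [Fintype κ] {n : ℕ}
    (q : Fin n → κ → ℝ) (s : Fin n → E) (c : κ → E) (v : E) :
    meanLoss q (fun m => s m - v) (fun j => c j - v) = meanLoss q s c := by
  simp only [meanLoss, sub_sub_sub_cancel_right]

/-- The left side is `E‖f - c‖²` by the bias-variance decomposition. A center far from the mean
therefore forces a small variance, and the two contributions to the surrogate share a single `Δ`. -/
lemma sq_norm_sub_mean_add_integral_le {E α : Type*} [NormedAddCommGroup E]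
    [InnerProductSpace ℝ E] [CompleteSpace E] [MeasurableSpace α] (D : Measure α)
    [IsProbabilityMeasure D] {f : α → E} {B : ℝ} (hf : AEStronglyMeasurable f D)
    (hB : ∀ x, ‖f x‖ ≤ B) {c : E} {Δ : ℝ} (hc : ∀ x, ‖f x - c‖ ^ 2 ≤ Δ) :
    ‖c - ∫ x, f x ∂D‖ ^ 2 + ∫ x, ‖f x - ∫ y, f y ∂D‖ ^ 2 ∂D ≤ Δ := by
  set μ := ∫ x, f x ∂D
  have hfi : Integrable f D := .of_bound hf B (Filter.Eventually.of_forall hB)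
  have hYi : Integrable (fun x => f x - μ) D := hfi.sub (integrable_const _)
  have hY0 : ∫ x, (f x - μ) ∂D = 0 := by
    rw [integral_sub hfi (integrable_const _), integral_const, probReal_univ, one_smul, sub_self]
  have hYsq : Integrable (fun x => ‖f x - μ‖ ^ 2) D := by
    refine .of_bound (hYi.aestronglyMeasurable.norm.pow 2) ((B + ‖μ‖) ^ 2)
      (Filter.Eventually.of_forall fun x => ?_)
    rw [Real.norm_of_nonneg (by positivity)]
    gcongr
    exact (norm_sub_le _ _).trans (add_le_add_left (hB x) _)
  have hYc : Integrable (fun x => (inner ℝ (c - μ) (f x - μ) : ℝ)) D := hYi.const_inner _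
  have e : ∀ x, ‖f x - c‖ ^ 2 = ‖f x - μ‖ ^ 2 - 2 * inner ℝ (c - μ) (f x - μ) + ‖c - μ‖ ^ 2 := by
    intro x
    rw [real_inner_comm, ← norm_sub_sq_real, sub_sub_sub_cancel_right]
  have hsub : Integrable (fun x => ‖f x - μ‖ ^ 2 - 2 * inner ℝ (c - μ) (f x - μ)) D :=
    hYsq.sub (hYc.const_mul 2)
  have h1 : ∫ x, ‖f x - c‖ ^ 2 ∂D = ‖c - μ‖ ^ 2 + ∫ x, ‖f x - μ‖ ^ 2 ∂D := by
    simp_rw [e]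
    rw [integral_add hsub (integrable_const _), integral_sub hYsq (hYc.const_mul 2),
      integral_const_mul, integral_inner hYi, hY0, inner_zero_right, integral_const, probReal_univ,
      one_smul]
    ring
  rw [← h1]
  have h2 : Integrable (fun x => ‖f x - c‖ ^ 2) D := by
    simp_rw [e]
    exact hsub.add (integrable_const _)
  refine (integral_mono h2 (integrable_const Δ) hc).trans_eq ?_
  simp

variable {d dz dφ dθ K n : ℕ}
  {𝒳 : Set (EuclideanSpace ℝ (Fin d))} {𝒵 : Set (EuclideanSpace ℝ (Fin dz))}
  {Φ : Set (EuclideanSpace ℝ (Fin dφ))} {Θ : Set (EuclideanSpace ℝ (Fin dθ))}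

/-- The mean relative entropy between the latent indices and their permutation average. -/
noncomputable def meanEntropy (D : Measure 𝒳) (enc : Kernel (EncParam K 𝒵 Φ × 𝒳) (Fin K))
    (alg : Kernel (Fin n → 𝒳) (Param K 𝒵 Φ Θ)) : ℝ :=
  ∫ z, permEntropy (indexMass enc z.2.2.1 (Fin.append z.1 z.2.1)) ∂(trainTestLaw D alg)

lemma integrable_permEntropy (D : Measure 𝒳) [IsProbabilityMeasure D]
    (enc : Kernel (EncParam K 𝒵 Φ × 𝒳) (Fin K)) [IsMarkovKernel enc]
    (alg : Kernel (Fin n → 𝒳) (Param K 𝒵 Φ Θ)) [IsMarkovKernel alg] :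
    Integrable (fun z => permEntropy (indexMass enc z.2.2.1 (Fin.append z.1 z.2.1)))
      (trainTestLaw D alg) := by
  have happ : Measurable fun z : (Fin n → 𝒳) × ((Fin n → 𝒳) × Param K 𝒵 Φ Θ) =>
      Fin.append z.1 z.2.1 :=
    (measurePreserving_append D).measurable.comp
      (measurable_fst.prodMk (measurable_fst.comp measurable_snd))
  have hφ : Measurable fun z : (Fin n → 𝒳) × ((Fin n → 𝒳) × Param K 𝒵 Φ Θ) =>
      (z.2.2.1, Fin.append z.1 z.2.1) := Measurable.prodMk (by fun_prop) happ
  refine .of_bound ((measurable_permEntropy_indexMass enc).comp hφ).aestronglyMeasurable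
    (Real.log (n + n).factorial) (Filter.Eventually.of_forall fun z => ?_)
  rw [Real.norm_of_nonneg (permEntropy_nonneg (indexMass_nonneg _ _ _) (sum_indexMass _ _ _))]
  exact permEntropy_le (indexMass_nonneg _ _ _) (sum_indexMass _ _ _)

lemma expectedKL_eq_ofReal (D : Measure 𝒳) [IsProbabilityMeasure D]
    (enc : Kernel (EncParam K 𝒵 Φ × 𝒳) (Fin K)) [IsMarkovKernel enc]
    (alg : Kernel (Fin n → 𝒳) (Param K 𝒵 Φ Θ)) [IsMarkovKernel alg] :
    expectedKL D enc alg = ENNReal.ofReal (meanEntropy D enc alg) := by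
  rw [expectedKL_eq, meanEntropy,
    ofReal_integral_eq_lintegral_ofReal (integrable_permEntropy D enc alg)
      (Filter.Eventually.of_forall fun z =>
        permEntropy_nonneg (indexMass_nonneg _ _ _) (sum_indexMass _ _ _))]

lemma meanEntropy_nonneg (D : Measure 𝒳)
    (enc : Kernel (EncParam K 𝒵 Φ × 𝒳) (Fin K)) [IsMarkovKernel enc]
    (alg : Kernel (Fin n → 𝒳) (Param K 𝒵 Φ Θ)) : 0 ≤ meanEntropy D enc alg :=
  integral_nonneg fun _ => permEntropy_nonneg (indexMass_nonneg _ _ _) (sum_indexMass _ _ _)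

lemma genError_le_add (hn : 1 ≤ n) {Δ : ℝ} (hΔ : DiamLT 𝒳 Δ) (D : Measure 𝒳)
    [IsProbabilityMeasure D]
    (enc : Kernel (EncParam K 𝒵 Φ × 𝒳) (Fin K)) [IsMarkovKernel enc]
    {g : Θ → 𝒵 → 𝒳} (hg : Measurable (Function.uncurry g))
    (alg : Kernel (Fin n → 𝒳) (Param K 𝒵 Φ Θ)) [IsMarkovKernel alg] {t : ℝ} (ht : 0 < t) :
    genError D enc g alg ≤
      meanEntropy D enc alg / t + t * Δ ^ 2 / n + Δ / Real.sqrt n := by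
  have hdist := sq_norm_sub_le hΔ
  obtain ⟨hGi, hG⟩ := genError_eq hn D enc hg alg hdist
  set M := trainTestLaw D alg with hM
  obtain ⟨x₀⟩ : Nonempty 𝒳 := by
    by_contra h
    rw [not_nonempty_iff] at h
    exact IsProbabilityMeasure.ne_zero D (Measure.eq_zero_of_isEmpty D)
  have hfB : ∀ x : 𝒳, ‖(x : EuclideanSpace ℝ (Fin d))‖ ≤
      Real.sqrt Δ + ‖(x₀ : EuclideanSpace ℝ (Fin d))‖ := fun x => by
    have h1 := Real.le_sqrt_of_sq_le (hdist x x₀)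
    have h2 := norm_add_le ((x : EuclideanSpace ℝ (Fin d)) - x₀) x₀
    rw [sub_add_cancel] at h2
    linarith
  have hfm : Measurable fun x : 𝒳 => (x : EuclideanSpace ℝ (Fin d)) := measurable_subtype_coe
  set μ : EuclideanSpace ℝ (Fin d) := ∫ x, (x : EuclideanSpace ℝ (Fin d)) ∂D with hμ
  -- Losses are unchanged when data and centers are translated together, so everything may be
  -- centered at the mean of `D`.
  let Y : 𝒳 → EuclideanSpace ℝ (Fin d) := fun x => (x : EuclideanSpace ℝ (Fin d)) - μ
  have hY : Measurable Y := hfm.sub_const _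
  have hYB : ∀ x, ‖Y x‖ ≤ Real.sqrt Δ + ‖(x₀ : EuclideanSpace ℝ (Fin d))‖ + ‖μ‖ := fun x =>
    (norm_sub_le _ _).trans (add_le_add_left (hfB x) _)
  have hY0 : ∫ x, Y x ∂D = 0 := by
    have hfi : Integrable (fun x : 𝒳 => (x : EuclideanSpace ℝ (Fin d))) D :=
      .of_bound hfm.aestronglyMeasurable _ (Filter.Eventually.of_forall hfB)
    rw [integral_sub hfi (integrable_const _), integral_const, probReal_univ, one_smul, sub_self]
  set V := ∫ x, ‖Y x‖ ^ 2 ∂D with hV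
  -- The decoder takes values in `𝒳`, so this also bounds each centered center, and hence the
  -- averaged center `C`.
  have hYV : ∀ x : 𝒳, ‖Y x‖ ^ 2 ≤ Δ - V := fun x => by
    have := sq_norm_sub_mean_add_integral_le D hfm.aestronglyMeasurable hfB (c := x)
      (fun y => hdist y x)
    change ‖Y x‖ ^ 2 + V ≤ Δ at this
    linarith
  have hr0 : 0 ≤ Δ - V := (sq_nonneg _).trans (hYV x₀)
  let C : (Fin n → 𝒳) × Param K 𝒵 Φ Θ → EuclideanSpace ℝ (Fin d) := fun z =>
    meanCenter (indexMass enc z.2.1 z.1) fun j => Y (g z.2.2 (z.2.1.1 j))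
  have hC : Measurable C := by
    have hq : ∀ m j, Measurable fun z : (Fin n → 𝒳) × Param K 𝒵 Φ Θ =>
        indexMass enc z.2.1 z.1 m j := fun m j => by
      have hφ : Measurable fun z : (Fin n → 𝒳) × Param K 𝒵 Φ Θ => (z.2.1, z.1) := by fun_prop
      exact (measurable_indexMass enc m j).comp hφ
    have hc : ∀ j, Measurable fun z : (Fin n → 𝒳) × Param K 𝒵 Φ Θ =>
        Y (g z.2.2 (z.2.1.1 j)) := fun j =>
      ((measurable_center hg j).comp measurable_snd).sub_const _
    simp only [C, meanCenter, average]
    fun_prop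
  have hCr : ∀ z, ‖C z‖ ^ 2 ≤ Δ - V := fun z => by
    have := norm_meanCenter_le (indexMass_nonneg enc z.2.1 z.1) (sum_indexMass enc z.2.1 z.1)
      (Real.sqrt_nonneg (Δ - V)) (c := fun j => Y (g z.2.2 (z.2.1.1 j)))
      (fun j => Real.le_sqrt_of_sq_le (hYV _))
    calc ‖C z‖ ^ 2 ≤ Real.sqrt (Δ - V) ^ 2 := by gcongr
      _ = _ := Real.sq_sqrt hr0
  have hfst : (((Measure.pi fun _ : Fin n => D) ⊗ₘ alg).map Prod.fst) =
      Measure.pi fun _ : Fin n => D := Measure.fst_compProd _ _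
  obtain ⟨hHi, hH⟩ := abs_integral_centered_gap_le hn D
    ((Measure.pi fun _ : Fin n => D) ⊗ₘ alg) hfst hY hYB hY0 hC hCr
  rw [← hV, add_sub_cancel] at hH
  set G : (Fin n → 𝒳) × ((Fin n → 𝒳) × Param K 𝒵 Φ Θ) → ℝ := fun z =>
    (n : ℝ)⁻¹ * ∑ m, expectedLoss enc g z.2.2 (z.1 m)
      - (n : ℝ)⁻¹ * ∑ m, expectedLoss enc g z.2.2 (z.2.1 m)
  set H : (Fin n → 𝒳) × ((Fin n → 𝒳) × Param K 𝒵 Φ Θ) → ℝ := fun z =>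
    (n : ℝ)⁻¹ * (∑ m, ‖Y (z.1 m)‖ ^ 2 - ∑ m, ‖Y (z.2.1 m)‖ ^ 2)
      - 2 * inner ℝ (average (fun m => Y (z.1 m)) - average (fun m => Y (z.2.1 m))) (C z.2)
  have hYY : ∀ x y : 𝒳, ‖Y x - Y y‖ ^ 2 ≤ Δ := fun x y => by
    simpa only [Y, sub_sub_sub_cancel_right] using hdist x y
  have hpt : ∀ z, |G z - H z| ≤
      permEntropy (indexMass enc z.2.2.1 (Fin.append z.1 z.2.1)) / t + t * Δ ^ 2 / n := by
    rintro ⟨a, b, w⟩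
    have key := abs_meanLoss_sub_surrogateGap_le hn
      (indexMass_nonneg enc w.1 (Fin.append a b)) (sum_indexMass enc w.1 (Fin.append a b))
      (fun m => Y (a m)) (fun m => Y (b m)) (fun j => Y (g w.2 (w.1.1 j))) hΔ.1.le
      (fun m j => hYY _ _) (fun m m' => hYY _ _) (fun m m' => hYY _ _) (fun j j' => hYY _ _) ht
    have e1 : (fun m => indexMass enc w.1 (Fin.append a b) (Fin.castAdd n m)) =
        indexMass enc w.1 a := by
      ext m j
      simp only [indexMass, Fin.append_left]
    have e2 : (fun m => indexMass enc w.1 (Fin.append a b) (Fin.natAdd n m)) =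
        indexMass enc w.1 b := by
      ext m j
      simp only [indexMass, Fin.append_right]
    rw [e1, e2] at key
    simp only [Y] at key
    rw [meanLoss_sub_const, meanLoss_sub_const, meanLoss_indexMass, meanLoss_indexMass] at key
    exact key
  rw [hG]
  have hsplit : ∫ z, G z ∂M = ∫ z, (G z - H z) ∂M + ∫ z, H z ∂M := by
    rw [integral_sub hGi hHi, sub_add_cancel]
  rw [hsplit]
  refine (abs_add_le _ _).trans (add_le_add ?_ hH)
  have hent := integrable_permEntropy D enc alg
  refine (abs_integral_le_integral_abs).trans ((integral_mono (hGi.sub hHi).abs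
    ((hent.div_const t).add (integrable_const _)) hpt).trans_eq ?_)
  rw [integral_add' (hent.div_const t) (integrable_const _), integral_div, integral_const,
    probReal_univ, one_smul, meanEntropy]

end

end VQVAE

theorem theorem3 {d dz dφ dθ K n : ℕ} (hn : 1 ≤ n)
    (𝒳 : Set (EuclideanSpace ℝ (Fin d))) (𝒵 : Set (EuclideanSpace ℝ (Fin dz)))
    (Φ : Set (EuclideanSpace ℝ (Fin dφ))) (Θ : Set (EuclideanSpace ℝ (Fin dθ)))
    (Δ : ℝ) (hΔ : VQVAE.DiamLT 𝒳 Δ)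
    (D : Measure 𝒳) [IsProbabilityMeasure D]
    (enc : Kernel (VQVAE.EncParam K 𝒵 Φ × 𝒳) (Fin K)) [IsMarkovKernel enc]
    (g : Θ → 𝒵 → 𝒳) (hg : Measurable (Function.uncurry g))
    (alg : Kernel (Fin n → 𝒳) (VQVAE.Param K 𝒵 Φ Θ)) [IsMarkovKernel alg] :
    VQVAE.expectedKL D enc alg ≠ ∞ ∧
      VQVAE.genError D enc g alg ≤
        3 * Δ * Real.sqrt ((VQVAE.expectedKL D enc alg).toReal / n) + Δ / Real.sqrt n := by
  have hk := VQVAE.meanEntropy_nonneg D enc alg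
  rw [VQVAE.expectedKL_eq_ofReal, ENNReal.toReal_ofReal hk]
  refine ⟨ENNReal.ofReal_ne_top, ?_⟩
  have h : VQVAE.genError D enc g alg - Δ / Real.sqrt n ≤
      2 * Δ * Real.sqrt (VQVAE.meanEntropy D enc alg / n) :=
    VQVAE.le_of_forall_le_div_add_mul hk hΔ.1 (by positivity) fun t ht => by
      linarith [VQVAE.genError_le_add hn hΔ D enc hg alg ht]
  -- The argument gives the constant `2`; this nonnegative term is the slack up to `3`.
  have h0 : 0 ≤ Δ * Real.sqrt (VQVAE.meanEntropy D enc alg / n) :=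
    mul_nonneg hΔ.1.le (Real.sqrt_nonneg _)
  linarith
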